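/- Let $n\ge 1$, let indices $a,b,c$ run from $1$ to $n+1$ and $i,j,k$ from $1$ to $n$ (repeated indices are summed), and write $\alpha\odot\beta$ for the quadratic form $\xi\mapsto\alpha(\xi)\beta(\xi)$. Let a projective structure (a class of torsion-free affine connections with the same unparametrized geodesics) be given on an $(n+1)$-dimensional manifold $\underline M$, let $(x^a)$ be local coordinates on an open set $U\subset\underline M$, and let $\Gamma^c_{ab}=\Gamma^c_{ba}$ be the Christoffel symbols of a connection from the class with $\sum_a\Gamma^a_{ac}=0$. On $M=\mathcal P T^*\underline M$ use the local coordinates $(x^i,u=x^{n+1},p_i)$ of the line spanned by $du-p_i\,dx^i$, and let $M$ carry the induced LC (Legendrian contact) structure $\mathcal D=E\oplus F$: $\mathcal D$ is the kernel of the tautological form, $F$ is the vertical distribution, and $E$ is the common intersection of the projections to $TM$ of the horizontal distributions in $TT^*\underline M$ of all connections of the class. In these coordinates $E=\ker\langle\sigma,\pi_j\rangle$ and $F=\ker\langle\sigma,\theta^i\rangle$ for a unique coframe of the form $\sigma=du-p_i\,dx^i$, $\theta^i=dx^i$, $\pi_j=dp_j-f_{ij}\,dx^i$, where $f_{ij}=f_{ji}$.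 Let $P\subset SL(n+2,\mathbb R)$ be the block upper triangular subgroup with blocks of sizes $1,n,1$, let $Q\subset P$ be its subgroup of elements whose two corner diagonal entries have product $1$, and let $\mathfrak q\subset\mathfrak p\subset\mathfrak g=\mathfrak{sl}(n+2,\mathbb R)$ be the Lie algebras. Number rows and columns from $0$ to $n+1$. Let $(\mathcal G\to M,\omega)$ be the normal parabolic geometry of type $(SL(n+2,\mathbb R),P)$ of the LC structure (curvature in the kernel of the Kostant codifferential; $E$ and $F$ correspond to the lower left blocks in columns $0$ and in row $n+1$, respectively). The Fefferman space is $\widetilde M=\mathcal G/Q$, and its conformal structure (metrics up to nowhere vanishing smooth factors) is the one induced through $\omega$ by the quadratic form $$\begin{bmatrix} z&*&*\\ X&*&*\\ w&Y^t&z\end{bmatrix}\mapsto Y^tX+2zw\quad\text{on }\mathfrak g/\mathfrak q .$$ Let $W$ be any open subset of the coordinate domain in $M$ over $U$. Then there is a local section $\phi$ of $\mathcal G$ over $W$ whose gauge $\phi^*\omega$ has the entries $\sigma$ in position $(n+1,0)$, $\theta^i$ in position $(i,0)$ and $\pi_j$ in position $(n+1,j)$. For every such $\phi$, let $s\in\mathbb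 R$ be the fiber coordinate on each of the two components of $\widetilde M|_W$ for which the point $(m,s)$ is the class of $\phi(m)\exp(sK)$, respectively $\phi(m)\,J\exp(sK)$, where $K=\mathrm{diag}(1,-\tfrac2n,\dots,-\tfrac2n,1)$ and $J=\mathrm{diag}(1,\dots,1,-1,-1)$. Then on each component the Fefferman conformal class contains the metric $$\widetilde g=\bigl(\Gamma^{n+1}_{bc}-p_k\Gamma^k_{bc}\bigr)\,dx^b\odot dx^c+dx^i\odot dp_i+2\,(dx^{n+1}-p_i\,dx^i)\odot ds .$$ Moreover, let $(x^a,y_a)$ be the canonical coordinates on $T^*\underline M$ over $U$ and let $$g=dx^a\odot dy_a-y_c\,\Gamma^c_{ab}\,dx^a\odot dx^b$$ be the Patterson–Walker metric. The transformation $$\Phi:\quad x^a=x^a,\qquad p_i=-\frac{y_i}{y_{n+1}},\qquad s=-\tfrac12\log|y_{n+1}|$$ is a diffeomorphism of each of the two sets $\{y_{n+1}>0\}$ and $\{y_{n+1}<0\}$ over $U$ onto $U\times\mathbb R^n\times\mathbb R$, and $g=-y_{n+1}\,\Phi^*\widetilde g$ there. That is, $\Phi$ relates $\widetilde g$ to the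 Patterson–Walker metric up to the conformal factor $-y_{n+1}$. -/

import Mathlib

open scoped ContDiff

noncomputable section

namespace LCFefferman

/-! ## Coordinates

`x : Fin (n+1) → ℝ` are coordinates `(x^a)` on the base manifold. Indices `1, …, n` correspond to
`Fin.castSucc i` with `i : Fin n`, and the index `n+1` corresponds to `Fin.last n`, so that
`x (Fin.last n)` is the coordinate `u = x^{n+1}`. -/

/-- Coordinates `(x^a)` on the base. -/
abbrev Base (n : ℕ) := Fin (n + 1) → ℝ

/-- Coordinates `(x^a, y_a)` on the cotangent bundle of the base. -/
abbrev Cot (n : ℕ) := Base n × (Fin (n + 1) → ℝ)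

/-- Affine coordinates `(x^i, u = x^{n+1}, p_i)` on the projectivized cotangent bundle: the point
`(x, p)` is the line spanned by the covector `du - p_i dx^i` at `x`. -/
abbrev Chart (n : ℕ) := Base n × (Fin n → ℝ)

/-- Coordinates `(x^a, p_i, s)` on (one of the two components of) the Fefferman space. -/
abbrev FSpace (n : ℕ) := Chart n × ℝ

abbrev Mat (n : ℕ) := Matrix (Fin (n + 2)) (Fin (n + 2)) ℝ

/-- Christoffel symbols: `Γ x c a b` is `Γ^c_{ab}` at `x`. -/
abbrev Christoffel (n : ℕ) := Base n → Fin (n + 1) → Fin (n + 1) → Fin (n + 1) → ℝ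

/-! ## Projective structures and the induced LC structure -/

/-- `Γ` defines a smooth torsion-free affine connection on `U`. -/
structure IsTorsionFreeConnection {n : ℕ} (U : Set (Base n)) (Γ : Christoffel n) : Prop where
  smooth : ∀ c a b, ContDiffOn ℝ ∞ (fun x => Γ x c a b) U
  symm : ∀ x ∈ U, ∀ c a b, Γ x c a b = Γ x c b a

/-- Projective equivalence of torsion-free connections on `U`:
`Γ'^c_{ab} = Γ^c_{ab} + δ^c_a Υ_b + δ^c_b Υ_a` for some smooth one-form `Υ`. -/
def ProjEquiv {n : ℕ} (U : Set (Base n)) (Γ Γ' : Christoffel n) : Prop :=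
  ∃ Υ : Base n → Fin (n + 1) → ℝ,
    (∀ a, ContDiffOn ℝ ∞ (fun x => Υ x a) U) ∧
    ∀ x ∈ U, ∀ c a b, Γ' x c a b
      = Γ x c a b + (if c = a then Υ x b else 0) + (if c = b then Υ x a else 0)

/-- The projection of `{y_{n+1} ≠ 0}` in the cotangent bundle to the affine chart of the
projectivized cotangent bundle, `p_i = - y_i / y_{n+1}`. -/
def toChart {n : ℕ} (z : Cot n) : Chart n :=
  (z.1, fun i => - z.2 (Fin.castSucc i) / z.2 (Fin.last n))

/-- The horizontal distribution of the connection `Γ` on the cotangent bundle: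
a tangent vector `(v, w)` at `(x, y)` is horizontal iff `w_a = Γ^c_{ab} y_c v^b`. -/
def horizontal {n : ℕ} (Γ : Christoffel n) (z : Cot n) : Set (Cot n) :=
  {η | ∀ a, η.2 a = ∑ c, ∑ b, Γ z.1 c a b * z.2 c * η.1 b}

/-- The contact distribution: the kernel of the tautological one-form `y_a dx^a`. -/
def lcD {n : ℕ} (m : Chart n) : Set (Chart n) :=
  {ξ | ∀ y : Fin (n + 1) → ℝ, y (Fin.last n) ≠ 0 → toChart (m.1, y) = m → ∑ a, y a * ξ.1 a = 0}

/-- The Legendrian distribution `E`: the common intersection of the (projected) horizontal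
distributions of all torsion-free connections projectively equivalent to `Γ`. -/
def lcE {n : ℕ} (U : Set (Base n)) (Γ : Christoffel n) (m : Chart n) : Set (Chart n) :=
  {ξ | ∀ Γ' : Christoffel n, ProjEquiv U Γ Γ' →
    ∀ y : Fin (n + 1) → ℝ, y (Fin.last n) ≠ 0 → toChart (m.1, y) = m →
      ∃ η ∈ horizontal Γ' (m.1, y), fderiv ℝ (toChart (n := n)) (m.1, y) η = ξ}

/-- The Legendrian distribution `F`: the vertical distribution over the base. -/
def lcF {n : ℕ} (_m : Chart n) : Set (Chart n) := {ξ | ξ.1 = 0}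

/-! ## Cartan gauges of type `(SL(n+2, ℝ), P)` -/

/-- Row and column blocks of sizes `1, n, 1`. The elementary matrix `E_{rs}` has degree
`blk s - blk r` in the contact grading of `sl(n+2, ℝ)`. -/
def blk {n : ℕ} (r : Fin (n + 2)) : ℕ :=
  if r = 0 then 0 else if r = Fin.last (n + 1) then 2 else 1

/-- The index of the middle block with number `i`. -/
def mid {n : ℕ} (i : Fin n) : Fin (n + 2) := (Fin.castSucc i).succ

/-- Block upper triangular matrices (the parabolic subalgebra when the trace vanishes). -/
def IsBlockUpper {n : ℕ} (X : Mat n) : Prop := ∀ r s, blk s < blk r → X r s = 0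

/-- A Cartan gauge of type `(SL(n+2, ℝ), P)` on `W`: a smooth one-form `A` with values in
`sl(n+2, ℝ)` inducing at every point an isomorphism of the tangent space with `g/p`
(injectivity suffices, since both spaces have dimension `2n+1`). -/
structure IsCartanGauge {n : ℕ} (W : Set (Chart n)) (A : Chart n → Chart n →ₗ[ℝ] Mat n) :
    Prop where
  smooth : ∀ v r s, ContDiffOn ℝ ∞ (fun m => A m v r s) W
  trace : ∀ m ∈ W, ∀ v, (A m v).trace = 0
  soldering : ∀ m ∈ W, ∀ v, IsBlockUpper (A m v) → v = 0

/-- The curvature `K(v, w) = dA(v, w) + [A(v), A(w)]` of a gauge. -/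
def gaugeCurvature {n : ℕ} (A : Chart n → Chart n →ₗ[ℝ] Mat n) (m v w : Chart n) : Mat n :=
  Matrix.of (fun r s => fderiv ℝ (fun m' => A m' w r s) m v - fderiv ℝ (fun m' => A m' v r s) m w)
    + (A m v * A m w - A m w * A m v)

/-- `κ` is the curvature function at `m`, i.e. the bilinear map on `g/p` (a bilinear map on
matrices vanishing on block upper triangular ones) with `κ(A(v), A(w)) = K(v, w)`. -/
def IsCurvatureFunction {n : ℕ} (A : Chart n → Chart n →ₗ[ℝ] Mat n) (m : Chart n)
    (κ : Mat n →ₗ[ℝ] Mat n →ₗ[ℝ] Mat n) : Prop :=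
  (∀ X Y, IsBlockUpper X → κ X Y = 0 ∧ κ Y X = 0) ∧
    ∀ v w, κ (A m v) (A m w) = gaugeCurvature A m v w

/-- Kostant codifferential of `κ`, evaluated at `X`:
`∑_α [Z^α, κ(X, X_α)] - (1/2) ∑_α κ([Z^α, X], X_α)`, where `X_α = E_{rs}` runs over the standard
basis of the strictly lower block triangular matrices and `Z^α = E_{sr}` is the basis of `p_+`
dual to it with respect to the trace form. -/
def kostantCodiff {n : ℕ} (κ : Mat n →ₗ[ℝ] Mat n →ₗ[ℝ] Mat n) (X : Mat n) : Mat n :=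
  ∑ r : Fin (n + 2), ∑ s : Fin (n + 2),
    if blk s < blk r then
      (Matrix.single s r (1 : ℝ) * κ X (Matrix.single r s 1)
        - κ X (Matrix.single r s 1) * Matrix.single s r (1 : ℝ))
      - (1 / 2 : ℝ) • κ (Matrix.single s r (1 : ℝ) * X - X * Matrix.single s r (1 : ℝ))
          (Matrix.single r s 1)
    else 0

/-- Normality: the curvature function takes values in the kernel of the codifferential. -/
def IsNormal {n : ℕ} (W : Set (Chart n)) (A : Chart n → Chart n →ₗ[ℝ] Mat n) : Prop :=
  ∀ m ∈ W, ∃ κ : Mat n →ₗ[ℝ] Mat n →ₗ[ℝ] Mat n,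
    IsCurvatureFunction A m κ ∧ ∀ X, kostantCodiff κ X = 0

/-- The LC structure underlying the gauge `A` is the one induced by the projective class of `Γ`:
`D`, `E`, `F` correspond to `g_{-1}`, `g_{-1}^E`, `g_{-1}^F` modulo `p`. -/
structure InducesLC {n : ℕ} (U : Set (Base n)) (Γ : Christoffel n) (W : Set (Chart n))
    (A : Chart n → Chart n →ₗ[ℝ] Mat n) : Prop where
  contact : ∀ m ∈ W, {v | A m v (Fin.last (n + 1)) 0 = 0} = lcD m
  legendreE : ∀ m ∈ W, {v | A m v (Fin.last (n + 1)) 0 = 0 ∧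
    ∀ j, A m v (Fin.last (n + 1)) (mid j) = 0} = lcE U Γ m
  legendreF : ∀ m ∈ W, {v | A m v (Fin.last (n + 1)) 0 = 0 ∧ ∀ i, A m v (mid i) 0 = 0} = lcF m

/-- The negative part of the gauge is an adapted coframe in the coordinates `(x^i, u, p_i)`:
`σ = du - p_i dx^i`, `θ^i = dx^i`, `π_j = dp_j - f_{ij} dx^i`. -/
structure IsAdapted {n : ℕ} (W : Set (Chart n)) (A : Chart n → Chart n →ₗ[ℝ] Mat n) : Prop where
  sigma : ∀ m ∈ W, ∀ v, A m v (Fin.last (n + 1)) 0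
    = v.1 (Fin.last n) - ∑ i, m.2 i * v.1 (Fin.castSucc i)
  theta : ∀ m ∈ W, ∀ v i, A m v (mid i) 0 = v.1 (Fin.castSucc i)
  pi : ∀ m ∈ W, ∃ f : Fin n → Fin n → ℝ, (∀ i j, f i j = f j i) ∧
    ∀ v j, A m v (Fin.last (n + 1)) (mid j) = v.2 j - ∑ i, f i j * v.1 (Fin.castSucc i)

/-- Gauges of the normal parabolic geometry of the LC structure induced by the projective class
of `Γ`, calibrated by the adapted coframe of the coordinates `(x^i, u, p_i)`. -/
structure IsNormalAdaptedGauge {n : ℕ} (U : Set (Base n)) (Γ : Christoffel n)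
    (W : Set (Chart n)) (A : Chart n → Chart n →ₗ[ℝ] Mat n) : Prop where
  cartan : IsCartanGauge W A
  normal : IsNormal W A
  induces : InducesLC U Γ W A
  adapted : IsAdapted W A

/-! ## The Fefferman conformal class

Over `W` the Cartan bundle is `W × P` with Cartan connection
`ω_{(m,h)}(v, H) = h⁻¹ A_m(v) h + h⁻¹ H`. The Fefferman space is its quotient by
`Q = {h ∈ P | h_{00} h_{n+1,n+1} = 1}`; its two components over `W` are parametrized by `(m, s)`
through the class of `(m, fiberCurve ε s)`, with `ε = false` or `ε = true`. -/

/-- `ε = false`: `exp (diag (s, -2s/n, …, -2s/n, s))`; `ε = true`: the same multiplied from the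
left by `diag (1, 1, …, 1, -1, -1)`. -/
def fiberCurve {n : ℕ} (ε : Bool) (s : ℝ) : Mat n :=
  Matrix.diagonal (fun r =>
    (if ε = true ∧ n ≤ r.val then -1 else 1) * Real.exp (if blk r = 1 then -(2 * s / n) else s))

/-- The Cartan connection on `W × P` determined by the gauge `A`. -/
def cartanForm {n : ℕ} (A : Chart n → Chart n →ₗ[ℝ] Mat n) (m : Chart n) (h : Mat n) :
    Chart n × Mat n →ₗ[ℝ] Mat n where
  toFun ξ := h⁻¹ * A m ξ.1 * h + h⁻¹ * ξ.2
  map_add' ξ η := by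
    simp only [Prod.fst_add, Prod.snd_add, map_add, Matrix.mul_add, Matrix.add_mul]
    abel
  map_smul' c ξ := by
    simp only [Prod.smul_fst, Prod.smul_snd, map_smul, Matrix.mul_smul, Matrix.smul_mul,
      smul_add, RingHom.id_apply]

/-- The derivative of the lift `(m, s) ↦ (m, fiberCurve ε s)` at `(m, s)`. -/
def liftDeriv {n : ℕ} (ε : Bool) (s : ℝ) : FSpace n →ₗ[ℝ] Chart n × Mat n where
  toFun ξ := (ξ.1, ξ.2 • Matrix.of (fun r t => deriv (fun τ => (fiberCurve ε τ : Mat n) r t) s))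
  map_add' ξ η := by
    simp only [Prod.fst_add, Prod.snd_add, add_smul, Prod.mk_add_mk]
  map_smul' c ξ := by
    simp only [Prod.smul_fst, Prod.smul_snd, smul_eq_mul, mul_smul, Prod.smul_mk,
      RingHom.id_apply]

/-- A matrix entry as a linear form. -/
def entry {n : ℕ} (r s : Fin (n + 2)) : Mat n →ₗ[ℝ] ℝ := Matrix.entryLinearMap ℝ ℝ r s

/-- The quadratic form `Yᵗ X + 2 z w` on `g/q`, where `X = (X_{i0})`, `Y = (X_{n+1,j})`,
`w = X_{n+1,0}` and `2 z = X_{00} + X_{n+1,n+1}`. -/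
def feffermanForm (n : ℕ) : QuadraticForm ℝ (Mat n) :=
  ∑ i : Fin n, QuadraticMap.linMulLin (entry (Fin.last (n + 1)) (mid i)) (entry (mid i) 0)
    + QuadraticMap.linMulLin (entry 0 0 + entry (Fin.last (n + 1)) (Fin.last (n + 1)))
        (entry (Fin.last (n + 1)) 0)

/-- The Fefferman conformal class over `W` determined by the gauge `A`, on the component `ε` and in
the coordinates `(m, s)`: nowhere vanishing smooth multiples of `feffermanForm ∘ ω`. -/
def feffermanClass {n : ℕ} (W : Set (Chart n)) (A : Chart n → Chart n →ₗ[ℝ] Mat n) (ε : Bool) :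
    Set (FSpace n → QuadraticForm ℝ (FSpace n)) :=
  {g | ∃ lam : FSpace n → ℝ, ContDiffOn ℝ ∞ lam {z | z.1 ∈ W} ∧ ∀ z : FSpace n, z.1 ∈ W →
    lam z ≠ 0 ∧
    g z = lam z • (feffermanForm n).comp
      ((cartanForm A z.1 (fiberCurve ε z.2)).comp (liftDeriv ε z.2))}

/-! ## The explicit metrics; `linMulLin α β` is the quadratic form `α ⊙ β : ξ ↦ α(ξ) β(ξ)` -/

/-- `dx^a` on the Fefferman space. -/
def dx {n : ℕ} (a : Fin (n + 1)) : FSpace n →ₗ[ℝ] ℝ :=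
  LinearMap.proj a ∘ₗ LinearMap.fst ℝ (Base n) (Fin n → ℝ) ∘ₗ LinearMap.fst ℝ (Chart n) ℝ

/-- `dp_i` on the Fefferman space. -/
def dp {n : ℕ} (i : Fin n) : FSpace n →ₗ[ℝ] ℝ :=
  LinearMap.proj i ∘ₗ LinearMap.snd ℝ (Base n) (Fin n → ℝ) ∘ₗ LinearMap.fst ℝ (Chart n) ℝ

/-- `ds` on the Fefferman space. -/
def ds {n : ℕ} : FSpace n →ₗ[ℝ] ℝ := LinearMap.snd ℝ (Chart n) ℝ

/-- The metric `(Γ^{n+1}_{bc} - p_k Γ^k_{bc}) dx^b ⊙ dx^c + dx^i ⊙ dp_i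
+ 2 (dx^{n+1} - p_i dx^i) ⊙ ds`. -/
def explicitMetric {n : ℕ} (Γ : Christoffel n) (z : FSpace n) : QuadraticForm ℝ (FSpace n) :=
  (∑ b, ∑ c, (Γ z.1.1 (Fin.last n) b c - ∑ k : Fin n, z.1.2 k * Γ z.1.1 (Fin.castSucc k) b c) •
      QuadraticMap.linMulLin (dx b) (dx c))
    + ∑ i : Fin n, QuadraticMap.linMulLin (dx (Fin.castSucc i)) (dp i)
    + (2 : ℝ) • QuadraticMap.linMulLin
        (dx (Fin.last n) - ∑ i : Fin n, z.1.2 i • dx (Fin.castSucc i)) ds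

/-- The Patterson–Walker metric `dx^a ⊙ dy_a - y_c Γ^c_{ab} dx^a ⊙ dx^b`. -/
def pattersonWalker {n : ℕ} (Γ : Christoffel n) (z : Cot n) : QuadraticForm ℝ (Cot n) :=
  ∑ a, QuadraticMap.linMulLin
      (LinearMap.proj a ∘ₗ LinearMap.fst ℝ (Base n) (Fin (n + 1) → ℝ))
      (LinearMap.proj a ∘ₗ LinearMap.snd ℝ (Base n) (Fin (n + 1) → ℝ))
    - ∑ a, ∑ b, (∑ c, z.2 c * Γ z.1 c a b) • QuadraticMap.linMulLin
        (LinearMap.proj a ∘ₗ LinearMap.fst ℝ (Base n) (Fin (n + 1) → ℝ))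
        (LinearMap.proj b ∘ₗ LinearMap.fst ℝ (Base n) (Fin (n + 1) → ℝ))

/-- The coordinate transformation `p_i = - y_i / y_{n+1}`, `s = - (1/2) log |y_{n+1}|`. -/
def coordChange {n : ℕ} (z : Cot n) : FSpace n :=
  (toChart z, -(1 / 2) * Real.log |z.2 (Fin.last n)|)

/-- `Φ` restricts to a smooth diffeomorphism of `S` onto `T`. -/
def IsDiffeoOn {n : ℕ} (Φ : Cot n → FSpace n) (S : Set (Cot n)) (T : Set (FSpace n)) : Prop :=
  ContDiffOn ℝ ∞ Φ S ∧ Set.MapsTo Φ S T ∧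
    ∃ Ψ : FSpace n → Cot n, ContDiffOn ℝ ∞ Ψ T ∧ Set.MapsTo Ψ T S ∧ Set.InvOn Ψ Φ S T

end LCFefferman

end

open scoped ContDiff

noncomputable section

namespace LCFefferman

/-! The Fefferman form sees only the lower blocks of a gauge and its corner trace `A_{00} +
A_{n+1,n+1}`. Along the two fiber curves, conjugation by the diagonal matrix changes the form by at
most a sign, and the Maurer–Cartan term adds `2 ds` to the corner trace
(`feffermanForm_cartanForm`). An adapted gauge has prescribed lower blocks, so everything rests on
the corner trace, which is found by uniqueness and existence.

Uniqueness (`corner_trace_unique`): two normal gauges with the same coframe have the same corner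
trace, although they may differ otherwise, for instance by conjugation with `1 + h E_{0,n+1}` for a
function `h`. Their difference `φ` is block upper triangular, and the lower blocks of the curvature
difference are linear in `φ` without derivatives. Traces of the normality equations kill both
corners of `φ` on the contact distribution. Hence the corner trace of `φ` is `λ σ`; its exterior
derivative contains `λ dσ`, which enters one more normality equation, and that equation forces `λ =
0`.

Existence (`isNormalAdaptedGauge_normalGauge`): the normal projective Cartan connection on the base
also has values in `sl(n+2, ℝ)`. Pulled back to the chart and conjugated by `1 + tilt Γ`, it
acquires the required coframe. It is normal for the LC geometry because its curvature vanishes on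
vertical vectors, has zero first column and has zero Ricci-type contraction. The coframe spans the
right `E` because projected horizontal spaces of projectively equivalent connections differ only by
multiples of `σ` (`mem_lcE_iff`).

The corner trace of this one gauge is explicit, and the substitution `u = σ + p_i dx^i` in the
quadratic form of `contracted Γ` (`contracted_quadratic`) yields the stated metric. The comparison
with the Patterson–Walker metric is an independent substitution, based on `y_c Γ^c_{ab} = y_{n+1}
(Γ^{n+1}_{ab} - p_k Γ^k_{ab})`. -/

theorem sum_blocks {n : ℕ} {M : Type*} [AddCommMonoid M] (f : Fin (n + 2) → M) :
    ∑ r, f r = f 0 + (∑ i : Fin n, f (mid i) + f (Fin.last (n + 1))) := by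
  rw [Fin.sum_univ_succ, Fin.sum_univ_castSucc]; rfl

theorem sum_base {n : ℕ} {M : Type*} [AddCommMonoid M] (f : Fin (n + 1) → M) :
    ∑ a, f a = ∑ i : Fin n, f (Fin.castSucc i) + f (Fin.last n) :=
  Fin.sum_univ_castSucc f

theorem index_cases {n : ℕ} {p : Fin (n + 2) → Prop} (h0 : p 0) (h1 : ∀ i, p (mid i))
    (h2 : p (Fin.last (n + 1))) (r : Fin (n + 2)) : p r := by
  refine Fin.cases h0 (fun a => ?_) r
  exact Fin.lastCases h2 h1 a

@[simp] theorem mid_ne_zero {n : ℕ} (i : Fin n) : mid i ≠ 0 := Fin.succ_ne_zero _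
@[simp] theorem zero_ne_mid {n : ℕ} (i : Fin n) : 0 ≠ mid i := (Fin.succ_ne_zero _).symm
@[simp] theorem mid_ne_last {n : ℕ} (i : Fin n) : mid i ≠ Fin.last (n + 1) := by
  intro h
  have := congrArg Fin.val h
  simp [mid] at this
  omega
@[simp] theorem last_ne_mid {n : ℕ} (i : Fin n) : Fin.last (n + 1) ≠ mid i :=
  (mid_ne_last i).symm
@[simp] theorem last_ne_zero' {n : ℕ} : Fin.last (n + 1) ≠ 0 := (Fin.last_pos).ne'
@[simp] theorem mid_inj {n : ℕ} {i j : Fin n} : mid i = mid j ↔ i = j := by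
  simp [mid]

@[simp] theorem blk_zero {n : ℕ} : blk (0 : Fin (n + 2)) = 0 := by simp [blk]
@[simp] theorem blk_mid {n : ℕ} (i : Fin n) : blk (mid i) = 1 := by simp [blk]
@[simp] theorem blk_last {n : ℕ} : blk (Fin.last (n + 1)) = 2 := by simp [blk]

theorem isBlockUpper_iff {n : ℕ} (X : Mat n) : IsBlockUpper X ↔
    (∀ i, X (mid i) 0 = 0) ∧ (∀ j, X (Fin.last (n + 1)) (mid j) = 0) ∧
      X (Fin.last (n + 1)) 0 = 0 := by
  constructor
  · intro h
    exact ⟨fun i => h _ _ (by simp), fun j => h _ _ (by simp), h _ _ (by simp)⟩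
  · rintro ⟨h1, h2, h3⟩ r s
    induction r using index_cases <;> induction s using index_cases <;> simp [*]

/-! ### The Kostant codifferential, entry by entry -/

theorem single_mul_entry {n : ℕ} (a b r s : Fin (n + 2)) (M : Mat n) :
    (Matrix.single a b (1 : ℝ) * M) r s = if r = a then M b s else 0 := by
  split_ifs with h
  · subst h; simp
  · exact Matrix.single_mul_apply_of_ne _ _ _ _ _ h _

theorem mul_single_entry {n : ℕ} (a b r s : Fin (n + 2)) (M : Mat n) :
    (M * Matrix.single a b (1 : ℝ)) r s = if s = b then M r a else 0 := by
  split_ifs with h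
  · subst h; simp
  · exact Matrix.mul_single_apply_of_ne _ _ _ _ _ h _

/-- The summand of the codifferential belonging to the basis element `E_{rs}`. -/
def codiffTerm {n : ℕ} (κ : Mat n →ₗ[ℝ] Mat n →ₗ[ℝ] Mat n) (X : Mat n)
    (r s : Fin (n + 2)) : Mat n :=
  (Matrix.single s r (1 : ℝ) * κ X (Matrix.single r s 1)
        - κ X (Matrix.single r s 1) * Matrix.single s r (1 : ℝ))
      - (1 / 2 : ℝ) • κ (Matrix.single s r (1 : ℝ) * X - X * Matrix.single s r (1 : ℝ))
          (Matrix.single r s 1)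

theorem kostantCodiff_eq {n : ℕ} (κ : Mat n →ₗ[ℝ] Mat n →ₗ[ℝ] Mat n) (X : Mat n) :
    kostantCodiff κ X = ∑ i, codiffTerm κ X (mid i) 0
      + (codiffTerm κ X (Fin.last (n + 1)) 0
        + ∑ j, codiffTerm κ X (Fin.last (n + 1)) (mid j)) := by
  unfold kostantCodiff
  simp only [sum_blocks (n := n), blk_zero, blk_mid, blk_last]
  simp [codiffTerm]

/-- The part of the codifferential that does not involve brackets in the arguments. -/
theorem kostantCodiff_apply {n : ℕ} (κ : Mat n →ₗ[ℝ] Mat n →ₗ[ℝ] Mat n) (X : Mat n)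
    (r s : Fin (n + 2)) :
    kostantCodiff κ X r s
      = ∑ i, ((if r = 0 then κ X (Matrix.single (mid i) 0 1) (mid i) s else 0)
          - (if s = mid i then κ X (Matrix.single (mid i) 0 1) r 0 else 0))
      + ((if r = 0 then κ X (Matrix.single (Fin.last (n + 1)) 0 1) (Fin.last (n + 1)) s else 0)
          - (if s = Fin.last (n + 1) then κ X (Matrix.single (Fin.last (n + 1)) 0 1) r 0 else 0))
      + ∑ j, ((if r = mid j then
            κ X (Matrix.single (Fin.last (n + 1)) (mid j) 1) (Fin.last (n + 1)) s else 0)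
          - (if s = Fin.last (n + 1) then
            κ X (Matrix.single (Fin.last (n + 1)) (mid j) 1) r (mid j) else 0))
      - (1 / 2 : ℝ) * (∑ i, κ (Matrix.single 0 (mid i) (1 : ℝ) * X
            - X * Matrix.single 0 (mid i) (1 : ℝ)) (Matrix.single (mid i) 0 1) r s
          + κ (Matrix.single 0 (Fin.last (n + 1)) (1 : ℝ) * X
            - X * Matrix.single 0 (Fin.last (n + 1)) (1 : ℝ))
              (Matrix.single (Fin.last (n + 1)) 0 1) r s
          + ∑ j, κ (Matrix.single (mid j) (Fin.last (n + 1)) (1 : ℝ) * X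
            - X * Matrix.single (mid j) (Fin.last (n + 1)) (1 : ℝ))
              (Matrix.single (Fin.last (n + 1)) (mid j) 1) r s) := by
  rw [kostantCodiff_eq]
  simp only [codiffTerm, Matrix.add_apply, Matrix.sum_apply, Matrix.sub_apply, Matrix.smul_apply,
    single_mul_entry, mul_single_entry, smul_eq_mul, Finset.sum_sub_distrib, ← Finset.mul_sum]
  ring

/-- `κ` factors through `g/p` in both arguments. -/
def IsHorizontalForm {n : ℕ} (κ : Mat n →ₗ[ℝ] Mat n →ₗ[ℝ] Mat n) : Prop :=
  ∀ X Y, IsBlockUpper X → κ X Y = 0 ∧ κ Y X = 0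

/-- On elements of filtration degree `-1` the codifferential has no bracket terms. -/
theorem kostantCodiff_apply_of_contact {n : ℕ} {κ : Mat n →ₗ[ℝ] Mat n →ₗ[ℝ] Mat n}
    (hκ : IsHorizontalForm κ) {X : Mat n} (hX : X (Fin.last (n + 1)) 0 = 0)
    (r s : Fin (n + 2)) :
    kostantCodiff κ X r s
      = ∑ i, ((if r = 0 then κ X (Matrix.single (mid i) 0 1) (mid i) s else 0)
          - (if s = mid i then κ X (Matrix.single (mid i) 0 1) r 0 else 0))
      + ((if r = 0 then κ X (Matrix.single (Fin.last (n + 1)) 0 1) (Fin.last (n + 1)) s else 0)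
          - (if s = Fin.last (n + 1) then κ X (Matrix.single (Fin.last (n + 1)) 0 1) r 0 else 0))
      + ∑ j, ((if r = mid j then
            κ X (Matrix.single (Fin.last (n + 1)) (mid j) 1) (Fin.last (n + 1)) s else 0)
          - (if s = Fin.last (n + 1) then
            κ X (Matrix.single (Fin.last (n + 1)) (mid j) 1) r (mid j) else 0)) := by
  have h1 : ∀ i : Fin n, IsBlockUpper (Matrix.single 0 (mid i) (1 : ℝ) * X
      - X * Matrix.single 0 (mid i) (1 : ℝ)) := fun i => by
    simp [isBlockUpper_iff, mul_single_entry, hX]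
  have h2 : IsBlockUpper (Matrix.single 0 (Fin.last (n + 1)) (1 : ℝ) * X
      - X * Matrix.single 0 (Fin.last (n + 1)) (1 : ℝ)) := by
    simp [isBlockUpper_iff]
  have h3 : ∀ j : Fin n, IsBlockUpper (Matrix.single (mid j) (Fin.last (n + 1)) (1 : ℝ) * X
      - X * Matrix.single (mid j) (Fin.last (n + 1)) (1 : ℝ)) := fun j => by
    simp [isBlockUpper_iff, single_mul_entry, hX]
  rw [kostantCodiff_apply]
  simp only [fun i => (hκ _ (Matrix.single (mid i) 0 1) (h1 i)).1,
    (hκ _ (Matrix.single (Fin.last (n + 1)) 0 1) h2).1,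
    fun i => (hκ _ (Matrix.single (Fin.last (n + 1)) (mid i) 1) (h3 i)).1, Matrix.zero_apply,
    Finset.sum_const_zero, add_zero, mul_zero, sub_zero]

/-- The sum of the two corner entries of the codifferential at the lowest root vector. -/
theorem kostantCodiff_lowest_corners {n : ℕ} {κ : Mat n →ₗ[ℝ] Mat n →ₗ[ℝ] Mat n}
    (hκ : IsHorizontalForm κ)
    (halt : ∀ i : Fin n, κ (Matrix.single (Fin.last (n + 1)) (mid i) 1)
      (Matrix.single (mid i) 0 1) = - κ (Matrix.single (mid i) 0 1)
      (Matrix.single (Fin.last (n + 1)) (mid i) 1))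
    (hTT : κ (Matrix.single (Fin.last (n + 1)) 0 1) (Matrix.single (Fin.last (n + 1)) 0 1) = 0) :
    kostantCodiff κ (Matrix.single (Fin.last (n + 1)) 0 1) 0 0
      + kostantCodiff κ (Matrix.single (Fin.last (n + 1)) 0 1) (Fin.last (n + 1)) (Fin.last (n + 1))
      = ∑ i, (κ (Matrix.single (Fin.last (n + 1)) 0 1) (Matrix.single (mid i) 0 1) (mid i) 0
        - κ (Matrix.single (Fin.last (n + 1)) 0 1) (Matrix.single (Fin.last (n + 1)) (mid i) 1)
            (Fin.last (n + 1)) (mid i)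
        - (κ (Matrix.single (mid i) 0 1) (Matrix.single (Fin.last (n + 1)) (mid i) 1) 0 0
          + κ (Matrix.single (mid i) 0 1) (Matrix.single (Fin.last (n + 1)) (mid i) 1)
            (Fin.last (n + 1)) (Fin.last (n + 1)))) := by
  -- Bracketing the lowest root vector with the two degree-one families of `p_+` gives, up to sign,
  -- the basis vectors of `F` and `E`. So the bracket terms survive here, each pair occurs twice,
  -- and by `halt` the factor `1/2` cancels.
  have h1 : ∀ i : Fin n, (Matrix.single 0 (mid i) (1 : ℝ) * Matrix.single (Fin.last (n + 1)) 0 1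
      - Matrix.single (Fin.last (n + 1)) 0 1 * Matrix.single 0 (mid i) (1 : ℝ) : Mat n)
      = - Matrix.single (Fin.last (n + 1)) (mid i) 1 := fun i => by
    rw [Matrix.single_mul_single_of_ne _ _ _ _ (mid_ne_last i), Matrix.single_mul_single_same]
    simp
  have h2 : IsBlockUpper (Matrix.single 0 (Fin.last (n + 1)) (1 : ℝ)
        * Matrix.single (Fin.last (n + 1)) 0 1
      - Matrix.single (Fin.last (n + 1)) 0 1 * Matrix.single 0 (Fin.last (n + 1)) (1 : ℝ)
      : Mat n) := by
    simp [isBlockUpper_iff]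
  have h3 : ∀ j : Fin n, (Matrix.single (mid j) (Fin.last (n + 1)) (1 : ℝ)
        * Matrix.single (Fin.last (n + 1)) 0 1
      - Matrix.single (Fin.last (n + 1)) 0 1 * Matrix.single (mid j) (Fin.last (n + 1)) (1 : ℝ)
      : Mat n) = Matrix.single (mid j) 0 1 := fun j => by
    rw [Matrix.single_mul_single_of_ne _ _ _ _ (zero_ne_mid j), Matrix.single_mul_single_same]
    simp
  rw [kostantCodiff_apply, kostantCodiff_apply]
  simp only [h1, h3, (hκ _ (Matrix.single (Fin.last (n + 1)) 0 1) h2).1, map_neg,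
    LinearMap.neg_apply, halt, hTT]
  simp [Finset.sum_add_distrib]
  ring

/-! ### Adapted gauges with prescribed coframe -/

/-- The negative part of `A` is the coframe `σ, θ^i, π_j = dp_j - f_{ij} dx^i`. -/
structure HasCoframe {n : ℕ} (f : Chart n → Fin n → Fin n → ℝ) (W : Set (Chart n))
    (A : Chart n → Chart n →ₗ[ℝ] Mat n) : Prop where
  sigma : ∀ m ∈ W, ∀ v, A m v (Fin.last (n + 1)) 0
    = v.1 (Fin.last n) - ∑ i, m.2 i * v.1 (Fin.castSucc i)
  theta : ∀ m ∈ W, ∀ v i, A m v (mid i) 0 = v.1 (Fin.castSucc i)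
  pi : ∀ m ∈ W, ∀ v j, A m v (Fin.last (n + 1)) (mid j)
    = v.2 j - ∑ i, f m i j * v.1 (Fin.castSucc i)

/-- The frame vector dual to `θ^i`. -/
def frameE {n : ℕ} (f : Chart n → Fin n → Fin n → ℝ) (m : Chart n) (i : Fin n) : Chart n :=
  (Pi.single (Fin.castSucc i) 1 + m.2 i • Pi.single (Fin.last n) 1, fun j => f m i j)

/-- The frame vector dual to `π_j`. -/
def frameF {n : ℕ} (j : Fin n) : Chart n := (0, Pi.single j 1)

/-- The frame vector dual to `σ`. -/
def frameT {n : ℕ} : Chart n := (Pi.single (Fin.last n) 1, 0)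

theorem frame_expansion {n : ℕ} (f : Chart n → Fin n → Fin n → ℝ) (m v : Chart n) :
    v = ∑ i, v.1 (Fin.castSucc i) • frameE f m i
      + ∑ j, (v.2 j - ∑ i, f m i j * v.1 (Fin.castSucc i)) • frameF j
      + (v.1 (Fin.last n) - ∑ i, m.2 i * v.1 (Fin.castSucc i)) • frameT := by
  refine Prod.ext (funext fun a => ?_) (funext fun k => ?_)
  · refine Fin.lastCases ?_ (fun k => ?_) a
    · simp [frameE, frameF, frameT, Prod.fst_sum, Finset.sum_apply, mul_comm]
    · simp [frameE, frameF, frameT, Prod.fst_sum, Finset.sum_apply, Pi.single_apply]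
  · simp [frameE, frameF, frameT, Prod.snd_sum, Finset.sum_apply, Pi.single_apply, mul_comm]

section frame
variable {n : ℕ} {f : Chart n → Fin n → Fin n → ℝ} {W : Set (Chart n)}
  {A : Chart n → Chart n →ₗ[ℝ] Mat n} (hA : HasCoframe f W A) {m : Chart n} (hm : m ∈ W)
include hA hm

theorem HasCoframe.sigma_E (k : Fin n) : A m (frameE f m k) (Fin.last (n + 1)) 0 = 0 := by
  simp [hA.sigma m hm, frameE, Pi.single_apply]

theorem HasCoframe.sigma_F (k : Fin n) : A m (frameF k) (Fin.last (n + 1)) 0 = 0 := by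
  simp [hA.sigma m hm, frameF]

theorem HasCoframe.sigma_T : A m frameT (Fin.last (n + 1)) 0 = 1 := by
  simp [hA.sigma m hm, frameT]

theorem HasCoframe.theta_E (k i : Fin n) :
    A m (frameE f m k) (mid i) 0 = if i = k then 1 else 0 := by
  simp [hA.theta m hm, frameE, Pi.single_apply]

theorem HasCoframe.theta_F (k i : Fin n) : A m (frameF k) (mid i) 0 = 0 := by
  simp [hA.theta m hm, frameF]

theorem HasCoframe.theta_T (i : Fin n) : A m frameT (mid i) 0 = 0 := by
  simp [hA.theta m hm, frameT]

theorem HasCoframe.pi_E (k j : Fin n) : A m (frameE f m k) (Fin.last (n + 1)) (mid j) = 0 := by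
  simp [hA.pi m hm, frameE, Pi.single_apply]

theorem HasCoframe.pi_F (k j : Fin n) :
    A m (frameF k) (Fin.last (n + 1)) (mid j) = if j = k then 1 else 0 := by
  simp [hA.pi m hm, frameF, Pi.single_apply]

theorem HasCoframe.pi_T (j : Fin n) : A m frameT (Fin.last (n + 1)) (mid j) = 0 := by
  simp [hA.pi m hm, frameT]

theorem HasCoframe.upper_E (k : Fin n) :
    IsBlockUpper (A m (frameE f m k) - Matrix.single (mid k) 0 1) := by
  rw [isBlockUpper_iff]
  refine ⟨fun i => ?_, fun j => ?_, ?_⟩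
  · simp [hA.theta_E hm, Matrix.single_apply, eq_comm]
  · simp [hA.pi_E hm]
  · simp [hA.sigma_E hm]

theorem HasCoframe.upper_F (k : Fin n) :
    IsBlockUpper (A m (frameF k) - Matrix.single (Fin.last (n + 1)) (mid k) 1) := by
  rw [isBlockUpper_iff]
  refine ⟨fun i => ?_, fun j => ?_, ?_⟩
  · simp [hA.theta_F hm]
  · simp [hA.pi_F hm, Matrix.single_apply, eq_comm]
  · simp [hA.sigma_F hm]

theorem HasCoframe.upper_T :
    IsBlockUpper (A m frameT - Matrix.single (Fin.last (n + 1)) 0 1) := by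
  rw [isBlockUpper_iff]
  refine ⟨fun i => ?_, fun j => ?_, ?_⟩
  · simp [hA.theta_T hm]
  · simp [hA.pi_T hm]
  · simp [hA.sigma_T hm]

end frame

/-- The curvature function depends only on classes modulo block upper triangular matrices. This lets
its values on elementary matrices be read off from the dual frame. -/
theorem IsCurvatureFunction.apply_eq {n : ℕ} {A : Chart n → Chart n →ₗ[ℝ] Mat n} {m : Chart n}
    {κ : Mat n →ₗ[ℝ] Mat n →ₗ[ℝ] Mat n} (h : IsCurvatureFunction A m κ) {v w : Chart n}
    {X Y : Mat n} (hX : IsBlockUpper (A m v - X)) (hY : IsBlockUpper (A m w - Y)) :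
    κ X Y = gaugeCurvature A m v w := by
  rw [← h.2 v w]
  have h1 := (h.1 _ (A m w) hX).1
  have h2 := (h.1 _ X hY).2
  rw [map_sub, LinearMap.sub_apply, sub_eq_zero] at h1
  rw [map_sub, sub_eq_zero] at h2
  rw [h1, h2]

theorem gaugeCurvature_swap {n : ℕ} (A : Chart n → Chart n →ₗ[ℝ] Mat n) (m v w : Chart n) :
    gaugeCurvature A m w v = - gaugeCurvature A m v w := by
  ext r s
  simp only [gaugeCurvature, Matrix.add_apply, Matrix.of_apply, Matrix.sub_apply, Matrix.neg_apply]
  ring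

theorem kostantCodiff_sub {n : ℕ} (κ κ' : Mat n →ₗ[ℝ] Mat n →ₗ[ℝ] Mat n) (X : Mat n) :
    kostantCodiff (κ - κ') X = kostantCodiff κ X - kostantCodiff κ' X := by
  simp only [kostantCodiff, ← Finset.sum_sub_distrib]
  refine Finset.sum_congr rfl fun r _ => Finset.sum_congr rfl fun s _ => ?_
  split_ifs
  · simp only [LinearMap.sub_apply, mul_sub, sub_mul, smul_sub]
    abel
  · simp

/-! ### Comparing two gauges with the same coframe -/

section compare
variable {n : ℕ} {f : Chart n → Fin n → Fin n → ℝ} {W : Set (Chart n)}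
  {A B : Chart n → Chart n →ₗ[ℝ] Mat n}

/-- Where an entry of the two gauges agrees on an open set, the derivative terms cancel and only the
brackets remain. -/
theorem gaugeCurvature_sub_apply (hW : IsOpen W) {m : Chart n} (hm : m ∈ W) {r s : Fin (n + 2)}
    (h : ∀ m ∈ W, ∀ v, A m v r s = B m v r s) (v w : Chart n) :
    gaugeCurvature A m v w r s - gaugeCurvature B m v w r s
      = (A m v * A m w - A m w * A m v) r s - (B m v * B m w - B m w * B m v) r s := by
  have key : ∀ u : Chart n, fderiv ℝ (fun m' => A m' u r s) m
      = fderiv ℝ (fun m' => B m' u r s) m := fun u =>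
    Filter.EventuallyEq.fderiv_eq (by
      filter_upwards [hW.mem_nhds hm] with m' hm' using h m' hm' u)
  simp only [gaugeCurvature, Matrix.add_apply, Matrix.of_apply, key]
  ring

variable (hW : IsOpen W) (hA : HasCoframe f W A) (hB : HasCoframe f W B)
  {m : Chart n} (hm : m ∈ W)
include hW hA hB hm

/-- Since the lower blocks of `A` and `B` coincide, the bracket terms in this entry and in the other
two lower blocks are linear in `A - B`, with coframe coefficients. Normality thereby becomes a
linear system for `A - B`. -/
theorem gaugeCurvature_sub_apply_last_zero (v w : Chart n) :
    gaugeCurvature A m v w (Fin.last (n + 1)) 0 - gaugeCurvature B m v w (Fin.last (n + 1)) 0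
      = A m v (Fin.last (n + 1)) 0 * (A m w - B m w) 0 0
        - A m w (Fin.last (n + 1)) 0 * (A m v - B m v) 0 0
        + (A m v - B m v) (Fin.last (n + 1)) (Fin.last (n + 1)) * A m w (Fin.last (n + 1)) 0
        - (A m w - B m w) (Fin.last (n + 1)) (Fin.last (n + 1)) * A m v (Fin.last (n + 1)) 0 := by
  rw [gaugeCurvature_sub_apply hW hm (fun m hm v => by rw [hA.sigma m hm, hB.sigma m hm])]
  simp only [Matrix.sub_apply, Matrix.mul_apply, sum_blocks (n := n), hA.sigma m hm,
    hB.sigma m hm, hA.theta m hm, hB.theta m hm, hA.pi m hm, hB.pi m hm]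
  ring

theorem gaugeCurvature_sub_apply_mid_zero (v w : Chart n) (i : Fin n) :
    gaugeCurvature A m v w (mid i) 0 - gaugeCurvature B m v w (mid i) 0
      = A m v (mid i) 0 * (A m w - B m w) 0 0 - A m w (mid i) 0 * (A m v - B m v) 0 0
        + ∑ l, ((A m v - B m v) (mid i) (mid l) * A m w (mid l) 0
          - (A m w - B m w) (mid i) (mid l) * A m v (mid l) 0)
        + (A m v - B m v) (mid i) (Fin.last (n + 1)) * A m w (Fin.last (n + 1)) 0
        - (A m w - B m w) (mid i) (Fin.last (n + 1)) * A m v (Fin.last (n + 1)) 0 := by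
  rw [gaugeCurvature_sub_apply hW hm (fun m hm v => by rw [hA.theta m hm, hB.theta m hm])]
  simp only [Matrix.sub_apply, Matrix.mul_apply, sum_blocks (n := n), hA.sigma m hm,
    hB.sigma m hm, hA.theta m hm, hB.theta m hm, sub_mul, Finset.sum_sub_distrib]
  ring

theorem gaugeCurvature_sub_apply_last_mid (v w : Chart n) (j : Fin n) :
    gaugeCurvature A m v w (Fin.last (n + 1)) (mid j)
        - gaugeCurvature B m v w (Fin.last (n + 1)) (mid j)
      = A m v (Fin.last (n + 1)) 0 * (A m w - B m w) 0 (mid j)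
        - A m w (Fin.last (n + 1)) 0 * (A m v - B m v) 0 (mid j)
        + ∑ l, (A m v (Fin.last (n + 1)) (mid l) * (A m w - B m w) (mid l) (mid j)
          - A m w (Fin.last (n + 1)) (mid l) * (A m v - B m v) (mid l) (mid j))
        + (A m v - B m v) (Fin.last (n + 1)) (Fin.last (n + 1)) * A m w (Fin.last (n + 1)) (mid j)
        - (A m w - B m w) (Fin.last (n + 1)) (Fin.last (n + 1))
          * A m v (Fin.last (n + 1)) (mid j) := by
  rw [gaugeCurvature_sub_apply hW hm (fun m hm v => by rw [hA.pi m hm, hB.pi m hm])]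
  simp only [Matrix.sub_apply, Matrix.mul_apply, sum_blocks (n := n), hA.sigma m hm,
    hB.sigma m hm, hA.pi m hm, hB.pi m hm, mul_sub, Finset.sum_sub_distrib]
  ring

/-- The difference of the corner traces of the curvatures, on vectors for which the difference of
the corner traces of the gauges is a multiple of `σ`. -/
theorem gaugeCurvature_sub_corners (hAs : IsCartanGauge W A) (hBs : IsCartanGauge W B)
    (hS : ∀ m ∈ W, ∀ v, (A m v - B m v) 0 0
      + (A m v - B m v) (Fin.last (n + 1)) (Fin.last (n + 1))
      = ((A m frameT - B m frameT) 0 0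
        + (A m frameT - B m frameT) (Fin.last (n + 1)) (Fin.last (n + 1)))
        * A m v (Fin.last (n + 1)) 0) (k : Fin n) :
    (gaugeCurvature A m (frameE f m k) (frameF k) 0 0
        + gaugeCurvature A m (frameE f m k) (frameF k) (Fin.last (n + 1)) (Fin.last (n + 1)))
      - (gaugeCurvature B m (frameE f m k) (frameF k) 0 0
        + gaugeCurvature B m (frameE f m k) (frameF k) (Fin.last (n + 1)) (Fin.last (n + 1)))
      = ((A m frameT - B m frameT) 0 0
        + (A m frameT - B m frameT) (Fin.last (n + 1)) (Fin.last (n + 1)))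
        - (A m (frameF k) - B m (frameF k)) 0 (mid k)
        - (A m (frameE f m k) - B m (frameE f m k)) (mid k) (Fin.last (n + 1)) := by
  have hd : ∀ {C : Chart n → Chart n →ₗ[ℝ] Mat n}, IsCartanGauge W C → ∀ u r s,
      DifferentiableAt ℝ (fun m' => C m' u r s) m := fun hC u r s =>
    ((hC.smooth u r s).contDiffAt (hW.mem_nhds hm)).differentiableAt (by simp)
  set lam : Chart n → ℝ := fun m => (A m frameT - B m frameT) 0 0
        + (A m frameT - B m frameT) (Fin.last (n + 1)) (Fin.last (n + 1)) with hlam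
  have hlamd : DifferentiableAt ℝ lam m := by
    simp only [hlam, Matrix.sub_apply]
    exact ((hd hAs _ _ _).sub (hd hBs _ _ _)).add ((hd hAs _ _ _).sub (hd hBs _ _ _))
  -- Differentiating the identity `S = λ σ` for the difference `S` of the corner traces. The term
  -- with `dλ` drops out on contact vectors; the sum comes from the derivative of `σ` and takes the
  -- values `0` and `1` on the two orders of `E_k`, `F_k`.
  have hder : ∀ u v : Chart n,
      fderiv ℝ (fun m' => A m' u 0 0) m v - fderiv ℝ (fun m' => B m' u 0 0) m v
      + (fderiv ℝ (fun m' => A m' u (Fin.last (n + 1)) (Fin.last (n + 1))) m v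
      - fderiv ℝ (fun m' => B m' u (Fin.last (n + 1)) (Fin.last (n + 1))) m v)
      = fderiv ℝ lam m v * A m u (Fin.last (n + 1)) 0
        - lam m * ∑ i, v.2 i * u.1 (Fin.castSucc i) := fun u v => by
    have e1 : fderiv ℝ (fun m' => (A m' u - B m' u) 0 0
          + (A m' u - B m' u) (Fin.last (n + 1)) (Fin.last (n + 1))) m
        = fderiv ℝ (fun m' => lam m'
          * (u.1 (Fin.last n) - ∑ i, m'.2 i * u.1 (Fin.castSucc i))) m :=
      Filter.EventuallyEq.fderiv_eq (by
        filter_upwards [hW.mem_nhds hm] with m' hm'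
        rw [hS m' hm', hA.sigma m' hm'])
    have e2 : HasFDerivAt (fun m' : Chart n => u.1 (Fin.last n)
        - ∑ i, m'.2 i * u.1 (Fin.castSucc i))
        (- ∑ i, u.1 (Fin.castSucc i) • ((ContinuousLinearMap.proj i).comp
          (ContinuousLinearMap.snd ℝ (Base n) (Fin n → ℝ)))) m := by
      refine HasFDerivAt.const_sub (HasFDerivAt.fun_sum fun i _ => ?_) _
      exact (((ContinuousLinearMap.proj (R := ℝ) (φ := fun _ : Fin n => ℝ) i).comp
          (ContinuousLinearMap.snd ℝ (Base n) (Fin n → ℝ))).hasFDerivAt).mul_const _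
    rw [(hlamd.hasFDerivAt.fun_mul e2).fderiv] at e1
    simp only [Matrix.sub_apply] at e1
    rw [fderiv_fun_add ((hd hAs _ _ _).fun_sub (hd hBs _ _ _))
        ((hd hAs _ _ _).fun_sub (hd hBs _ _ _)),
      fderiv_fun_sub (hd hAs _ _ _) (hd hBs _ _ _), fderiv_fun_sub (hd hAs _ _ _) (hd hBs _ _ _)]
      at e1
    have e3 := congrArg (fun L => L v) e1
    simp only [_root_.add_apply, _root_.sub_apply] at e3
    rw [e3, hA.sigma m hm]
    simp [mul_comm]
    ring
  have hEF := hder (frameF k) (frameE f m k)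
  have hFE := hder (frameE f m k) (frameF k)
  simp only [hA.sigma_E hm, hA.sigma_F hm] at hEF hFE
  have s1 : ∑ i, (frameE f m k).2 i * (frameF (n := n) k).1 (Fin.castSucc i) = 0 := by
    simp [frameF]
  have s2 : ∑ i, (frameF (n := n) k).2 i * (frameE f m k).1 (Fin.castSucc i) = 1 := by
    simp [frameF, frameE, Pi.single_apply]
  rw [s1] at hEF
  rw [s2] at hFE
  simp only [gaugeCurvature, Matrix.add_apply, Matrix.of_apply, Matrix.sub_apply,
    Matrix.mul_apply, sum_blocks (n := n), hA.sigma_E hm, hA.sigma_F hm, hB.sigma_E hm,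
    hB.sigma_F hm, hA.theta_E hm, hB.theta_E hm, hA.theta_F hm, hB.theta_F hm, hA.pi_E hm,
    hB.pi_E hm, hA.pi_F hm, hB.pi_F hm]
  simp
  simp only [hlam, Matrix.sub_apply] at hEF hFE
  linarith

end compare

/-! ### Uniqueness of the corner trace -/

/-- The corner trace `A_{00} + A_{n+1,n+1}` of a normal gauge is determined by its coframe. -/
theorem corner_trace_unique {n : ℕ} {f : Chart n → Fin n → Fin n → ℝ}
    {W : Set (Chart n)} (hW : IsOpen W) {A B : Chart n → Chart n →ₗ[ℝ] Mat n}
    (hA : HasCoframe f W A) (hB : HasCoframe f W B)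
    (hAs : IsCartanGauge W A) (hBs : IsCartanGauge W B) (hAn : IsNormal W A) (hBn : IsNormal W B)
    {m : Chart n} (hm : m ∈ W) (v : Chart n) :
    A m v 0 0 + A m v (Fin.last (n + 1)) (Fin.last (n + 1))
      = B m v 0 0 + B m v (Fin.last (n + 1)) (Fin.last (n + 1)) := by
  have htr : ∀ m ∈ W, ∀ v, (A m v - B m v) 0 0 + (∑ i, (A m v - B m v) (mid i) (mid i)
      + (A m v - B m v) (Fin.last (n + 1)) (Fin.last (n + 1))) = 0 := fun m hm v => by
    have h1 := hAs.trace m hm v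
    have h2 := hBs.trace m hm v
    simp only [Matrix.trace, Matrix.diag, sum_blocks (n := n)] at h1 h2
    simp only [Matrix.sub_apply, Finset.sum_sub_distrib]
    linarith
  -- the difference of the curvature functions
  have hδ : ∀ m ∈ W, ∃ δ : Mat n →ₗ[ℝ] Mat n →ₗ[ℝ] Mat n, IsHorizontalForm δ ∧
      (∀ X, kostantCodiff δ X = 0) ∧ ∀ v w X Y, IsBlockUpper (A m v - X) →
        IsBlockUpper (B m v - X) → IsBlockUpper (A m w - Y) → IsBlockUpper (B m w - Y) →
        δ X Y = gaugeCurvature A m v w - gaugeCurvature B m v w := by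
    intro m hm
    obtain ⟨κ, hκ, hκn⟩ := hAn m hm
    obtain ⟨κ', hκ', hκn'⟩ := hBn m hm
    refine ⟨κ - κ', fun X Y hX => ?_, fun X => ?_, fun v w X Y h1 h2 h3 h4 => ?_⟩
    · simp [hκ.1 X Y hX, hκ'.1 X Y hX]
    · rw [kostantCodiff_sub, hκn, hκn', sub_zero]
    · rw [LinearMap.sub_apply, LinearMap.sub_apply, hκ.apply_eq h1 h3, hκ'.apply_eq h2 h4]
  -- homogeneity one
  have hE : ∀ m ∈ W, ∀ k, (A m (frameE f m k) - B m (frameE f m k)) 0 0 = 0 ∧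
      (A m (frameE f m k) - B m (frameE f m k)) (Fin.last (n + 1)) (Fin.last (n + 1)) = 0 := by
    intro m hm
    obtain ⟨δ, hδh, hδn, hδ⟩ := hδ m hm
    have kEE := fun k l => hδ _ _ _ _ (hA.upper_E hm k) (hB.upper_E hm k) (hA.upper_E hm l)
      (hB.upper_E hm l)
    have kEF := fun k l => hδ _ _ _ _ (hA.upper_E hm k) (hB.upper_E hm k) (hA.upper_F hm l)
      (hB.upper_F hm l)
    have kET := fun k => hδ _ _ _ _ (hA.upper_E hm k) (hB.upper_E hm k) (hA.upper_T hm)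
      (hB.upper_T hm)
    have q := fun k r s => (kostantCodiff_apply_of_contact hδh
      (X := Matrix.single (mid k) 0 1) (by simp) r s).symm.trans
        (congrFun (congrFun (hδn (Matrix.single (mid k) 0 1)) r) s)
    have tr := fun k => htr m hm (frameE f m k)
    set φ : Chart n → Mat n := fun v => A m v - B m v with hφ
    have vEE : ∀ k l i, δ (Matrix.single (mid k) 0 1) (Matrix.single (mid l) 0 1) (mid i) 0
        = (if i = k then φ (frameE f m l) 0 0 else 0) - (if i = l then φ (frameE f m k) 0 0 else 0)
          + φ (frameE f m k) (mid i) (mid l) - φ (frameE f m l) (mid i) (mid k) := fun k l i => by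
      rw [kEE, Matrix.sub_apply, gaugeCurvature_sub_apply_mid_zero hW hA hB hm]
      simp [hA.theta_E hm, hA.sigma_E hm, hφ]
      ring
    have vET : ∀ k, δ (Matrix.single (mid k) 0 1) (Matrix.single (Fin.last (n + 1)) 0 1)
        (Fin.last (n + 1)) 0 = φ (frameE f m k) (Fin.last (n + 1)) (Fin.last (n + 1))
          - φ (frameE f m k) 0 0 := fun k => by
      rw [kET, Matrix.sub_apply, gaugeCurvature_sub_apply_last_zero hW hA hB hm]
      simp [hA.sigma_E hm, hA.sigma_T hm, hφ]
      ring
    have vEF : ∀ k l j, δ (Matrix.single (mid k) 0 1)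
        (Matrix.single (Fin.last (n + 1)) (mid l) 1) (Fin.last (n + 1)) (mid j)
        = (if j = l then φ (frameE f m k) (Fin.last (n + 1)) (Fin.last (n + 1)) else 0)
          - φ (frameE f m k) (mid l) (mid j) := fun k l j => by
      rw [kEF, Matrix.sub_apply, gaugeCurvature_sub_apply_last_mid hW hA hB hm]
      simp [hA.sigma_E hm, hA.sigma_F hm, hA.pi_E hm, hA.pi_F hm, hφ]
      ring
    intro k
    -- Four linear equations, with `tr`, for four unknowns: the two corners of `φ(E_k)`, its middle
    -- trace, and the contraction `∑ φ(E_i)_{ik}`. `qN` and the trace give the last corner;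
    -- eliminating the contraction between `q0` and `qi` gives the first.
    have q0 := q k 0 0
    have qN := q k (Fin.last (n + 1)) (Fin.last (n + 1))
    have qi := Finset.sum_congr rfl fun i (_ : i ∈ Finset.univ) => q i (mid i) (mid k)
    simp [vEE, vET, vEF, Finset.sum_add_distrib] at q0 qN qi
    have tk := tr k
    refine ⟨?_, ?_⟩
    · have : ((n : ℝ) + 2) * φ (frameE f m k) 0 0 = 0 := by linarith
      exact (mul_eq_zero.mp this).resolve_left (by positivity)
    · have : ((n : ℝ) + 2) * φ (frameE f m k) (Fin.last (n + 1)) (Fin.last (n + 1)) = 0 := by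
        linarith
      exact (mul_eq_zero.mp this).resolve_left (by positivity)
  have hF : ∀ m ∈ W, ∀ k, (A m (frameF k) - B m (frameF k)) 0 0 = 0 ∧
      (A m (frameF k) - B m (frameF k)) (Fin.last (n + 1)) (Fin.last (n + 1)) = 0 := by
    intro m hm
    obtain ⟨δ, hδh, hδn, hδ⟩ := hδ m hm
    have kFE := fun k l => hδ _ _ _ _ (hA.upper_F hm k) (hB.upper_F hm k) (hA.upper_E hm l)
      (hB.upper_E hm l)
    have kFF := fun k l => hδ _ _ _ _ (hA.upper_F hm k) (hB.upper_F hm k) (hA.upper_F hm l)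
      (hB.upper_F hm l)
    have kFT := fun k => hδ _ _ _ _ (hA.upper_F hm k) (hB.upper_F hm k) (hA.upper_T hm)
      (hB.upper_T hm)
    have q := fun k r s => (kostantCodiff_apply_of_contact hδh
      (X := Matrix.single (Fin.last (n + 1)) (mid k) 1) (by simp) r s).symm.trans
        (congrFun (congrFun (hδn (Matrix.single (Fin.last (n + 1)) (mid k) 1)) r) s)
    have tr := fun k => htr m hm (frameF k)
    set φ : Chart n → Mat n := fun v => A m v - B m v with hφ
    have vFE : ∀ k l i, δ (Matrix.single (Fin.last (n + 1)) (mid k) 1)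
        (Matrix.single (mid l) 0 1) (mid i) 0
        = φ (frameF k) (mid i) (mid l) - (if i = l then φ (frameF k) 0 0 else 0) :=
        fun k l i => by
      rw [kFE, Matrix.sub_apply, gaugeCurvature_sub_apply_mid_zero hW hA hB hm]
      simp [hA.theta_E hm, hA.theta_F hm, hA.sigma_E hm, hA.sigma_F hm, hφ]
      ring
    have vFT : ∀ k, δ (Matrix.single (Fin.last (n + 1)) (mid k) 1)
        (Matrix.single (Fin.last (n + 1)) 0 1)
        (Fin.last (n + 1)) 0 = φ (frameF k) (Fin.last (n + 1)) (Fin.last (n + 1))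
          - φ (frameF k) 0 0 := fun k => by
      rw [kFT, Matrix.sub_apply, gaugeCurvature_sub_apply_last_zero hW hA hB hm]
      simp [hA.sigma_F hm, hA.sigma_T hm, hφ]
      ring
    have vFF : ∀ k l j, δ (Matrix.single (Fin.last (n + 1)) (mid k) 1)
        (Matrix.single (Fin.last (n + 1)) (mid l) 1) (Fin.last (n + 1)) (mid j)
        = φ (frameF l) (mid k) (mid j) - φ (frameF k) (mid l) (mid j)
          + (if j = l then φ (frameF k) (Fin.last (n + 1)) (Fin.last (n + 1)) else 0)
          - (if j = k then φ (frameF l) (Fin.last (n + 1)) (Fin.last (n + 1)) else 0) :=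
        fun k l j => by
      rw [kFF, Matrix.sub_apply, gaugeCurvature_sub_apply_last_mid hW hA hB hm]
      simp [hA.sigma_F hm, hA.pi_F hm, hφ]
    intro k
    -- The mirror system for `F`: now `q0` and the trace give the first corner, and `qN` with `qi`
    -- the last.
    have q0 := q k 0 0
    have qN := q k (Fin.last (n + 1)) (Fin.last (n + 1))
    have qi := Finset.sum_congr rfl fun i (_ : i ∈ Finset.univ) => q i (mid k) (mid i)
    simp [vFE, vFT, vFF, Finset.sum_add_distrib] at q0 qN qi
    have tk := tr k
    have h0 : φ (frameF k) 0 0 = 0 := by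
      have : ((n : ℝ) + 2) * φ (frameF k) 0 0 = 0 := by linarith
      exact (mul_eq_zero.mp this).resolve_left (by positivity)
    refine ⟨h0, ?_⟩
    have : ((n : ℝ) + 2) * φ (frameF k) (Fin.last (n + 1)) (Fin.last (n + 1)) = 0 := by
      linarith
    exact (mul_eq_zero.mp this).resolve_left (by positivity)
  -- homogeneity two
  have hS : ∀ m ∈ W, ∀ v, (A m v - B m v) 0 0
      + (A m v - B m v) (Fin.last (n + 1)) (Fin.last (n + 1))
      = ((A m frameT - B m frameT) 0 0
        + (A m frameT - B m frameT) (Fin.last (n + 1)) (Fin.last (n + 1)))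
        * A m v (Fin.last (n + 1)) 0 := by
    intro m hm v
    let S : Chart n →ₗ[ℝ] ℝ := (entry 0 0 + entry (Fin.last (n + 1)) (Fin.last (n + 1))).comp
      (A m - B m)
    have hSv : ∀ v, (A m v - B m v) 0 0 + (A m v - B m v) (Fin.last (n + 1)) (Fin.last (n + 1))
        = S v := fun v => rfl
    have h1 : ∀ k, S (frameE f m k) = 0 := fun k => by
      rw [← hSv, (hE m hm k).1, (hE m hm k).2, add_zero]
    have h2 : ∀ k, S (frameF k) = 0 := fun k => by
      rw [← hSv, (hF m hm k).1, (hF m hm k).2, add_zero]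
    rw [hSv, hSv, hA.sigma m hm]
    conv_lhs => rw [frame_expansion f m v]
    simp [h1, h2, mul_comm]
  have hlam : (A m frameT - B m frameT) 0 0
      + (A m frameT - B m frameT) (Fin.last (n + 1)) (Fin.last (n + 1)) = 0 := by
    obtain ⟨δ, hδh, hδn, hδ⟩ := hδ m hm
    have kEF := fun k => hδ _ _ _ _ (hA.upper_E hm k) (hB.upper_E hm k) (hA.upper_F hm k)
      (hB.upper_F hm k)
    have kFE := fun k => hδ _ _ _ _ (hA.upper_F hm k) (hB.upper_F hm k) (hA.upper_E hm k)
      (hB.upper_E hm k)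
    have kTE := fun k => hδ _ _ _ _ (hA.upper_T hm) (hB.upper_T hm) (hA.upper_E hm k)
      (hB.upper_E hm k)
    have kTF := fun k => hδ _ _ _ _ (hA.upper_T hm) (hB.upper_T hm) (hA.upper_F hm k)
      (hB.upper_F hm k)
    have kTT := hδ _ _ _ _ (hA.upper_T hm) (hB.upper_T hm) (hA.upper_T hm) (hB.upper_T hm)
    have hz : ∀ C : Chart n → Chart n →ₗ[ℝ] Mat n, gaugeCurvature C m frameT frameT = 0 :=
      fun C => by ext r s; simp [gaugeCurvature]
    have q := kostantCodiff_lowest_corners hδh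
      (fun i => by rw [kFE, kEF, gaugeCurvature_swap, gaugeCurvature_swap B]; abel)
      (by rw [kTT, hz, hz, sub_zero])
    have tr := htr m hm frameT
    have cor := gaugeCurvature_sub_corners hW hA hB hm hAs hBs hS
    set φ : Chart n → Mat n := fun v => A m v - B m v with hφ
    have vTE : ∀ k, δ (Matrix.single (Fin.last (n + 1)) 0 1) (Matrix.single (mid k) 0 1) (mid k) 0
        = φ frameT (mid k) (mid k) - φ frameT 0 0
          - φ (frameE f m k) (mid k) (Fin.last (n + 1)) := fun k => by
      rw [kTE, Matrix.sub_apply, gaugeCurvature_sub_apply_mid_zero hW hA hB hm]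
      simp [hA.theta_E hm, hA.theta_T hm, hA.sigma_E hm, hA.sigma_T hm, hφ]
      ring
    have vTF : ∀ k, δ (Matrix.single (Fin.last (n + 1)) 0 1)
        (Matrix.single (Fin.last (n + 1)) (mid k) 1) (Fin.last (n + 1)) (mid k)
        = φ (frameF k) 0 (mid k) - φ frameT (mid k) (mid k)
          + φ frameT (Fin.last (n + 1)) (Fin.last (n + 1)) := fun k => by
      rw [kTF, Matrix.sub_apply, gaugeCurvature_sub_apply_last_mid hW hA hB hm]
      simp [hA.sigma_F hm, hA.sigma_T hm, hA.pi_F hm, hA.pi_T hm, hφ]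
      ring
    have vEF : ∀ k, δ (Matrix.single (mid k) 0 1)
        (Matrix.single (Fin.last (n + 1)) (mid k) 1) 0 0
        + δ (Matrix.single (mid k) 0 1)
        (Matrix.single (Fin.last (n + 1)) (mid k) 1) (Fin.last (n + 1)) (Fin.last (n + 1))
        = φ frameT 0 0 + φ frameT (Fin.last (n + 1)) (Fin.last (n + 1))
          - φ (frameF k) 0 (mid k) - φ (frameE f m k) (mid k) (Fin.last (n + 1)) := fun k => by
      rw [kEF, Matrix.sub_apply, Matrix.sub_apply, ← cor k]
      ring
    -- The degree-two unknowns `φ(F_k)_{0k}` and `φ(E_k)_{k,n+1}` cancel in the sum of the two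
    -- corner equations. With the trace condition only `-(2n+2) λ` remains.
    rw [hδn] at q
    simp only [vTE, vTF, vEF] at q
    simp [Finset.sum_add_distrib] at q
    have : (2 * (n : ℝ) + 2) * (φ frameT 0 0
        + φ frameT (Fin.last (n + 1)) (Fin.last (n + 1))) = 0 := by
      linarith
    exact (mul_eq_zero.mp this).resolve_left (by positivity)
  have := hS m hm v
  rw [hlam, zero_mul] at this
  simp only [Matrix.sub_apply] at this
  linarith

/-! ### The induced LC structure in coordinates -/

/-- `G_{ab} = Γ^{n+1}_{ab} - p_k Γ^k_{ab}`. -/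
def contracted {n : ℕ} (Γ : Christoffel n) (m : Chart n) (a b : Fin (n + 1)) : ℝ :=
  Γ m.1 (Fin.last n) a b - ∑ k : Fin n, m.2 k * Γ m.1 (Fin.castSucc k) a b

/-- The tautological form `σ = du - p_i dx^i`. -/
def tautForm {n : ℕ} (m v : Chart n) : ℝ :=
  v.1 (Fin.last n) - ∑ i, m.2 i * v.1 (Fin.castSucc i)

/-- The functions `f_{ij}` with `E = ker ⟨du - p_i dx^i, dp_j - f_{ij} dx^i⟩`. -/
def slope {n : ℕ} (Γ : Christoffel n) (m : Chart n) (i j : Fin n) : ℝ :=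
  -(contracted Γ m (Fin.castSucc i) (Fin.castSucc j)
    + m.2 i * contracted Γ m (Fin.last n) (Fin.castSucc j)
    + m.2 j * contracted Γ m (Fin.last n) (Fin.castSucc i)
    + m.2 i * m.2 j * contracted Γ m (Fin.last n) (Fin.last n))

theorem contracted_symm {n : ℕ} {U : Set (Base n)} {Γ : Christoffel n}
    (hΓ : IsTorsionFreeConnection U Γ) {m : Chart n} (hm : m.1 ∈ U) (a b : Fin (n + 1)) :
    contracted Γ m a b = contracted Γ m b a := by
  simp only [contracted, fun c => hΓ.symm m.1 hm c a b]

theorem slope_symm {n : ℕ} {U : Set (Base n)} {Γ : Christoffel n}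
    (hΓ : IsTorsionFreeConnection U Γ) {m : Chart n} (hm : m.1 ∈ U) (i j : Fin n) :
    slope Γ m i j = slope Γ m j i := by
  simp only [slope, contracted_symm hΓ hm (Fin.castSucc i) (Fin.castSucc j)]
  ring

theorem toChart_eq_iff {n : ℕ} {m : Chart n} {y : Fin (n + 1) → ℝ} (hy : y (Fin.last n) ≠ 0) :
    toChart (m.1, y) = m ↔ ∀ i, y (Fin.castSucc i) = - m.2 i * y (Fin.last n) := by
  constructor
  · intro h i
    have := congrFun (congrArg Prod.snd h) i
    simp only [toChart] at this
    rw [← this]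
    field_simp
  · intro h
    refine Prod.ext rfl (funext fun i => ?_)
    simp only [toChart, h]
    field_simp

theorem exists_toChart_eq {n : ℕ} (m : Chart n) :
    ∃ y : Fin (n + 1) → ℝ, y (Fin.last n) ≠ 0 ∧ toChart (m.1, y) = m := by
  refine ⟨Fin.snoc (fun i => - m.2 i) 1, by simp, ?_⟩
  rw [toChart_eq_iff (by simp)]
  simp

theorem mem_lcD_iff {n : ℕ} (m v : Chart n) : v ∈ lcD m ↔ tautForm m v = 0 := by
  have key : ∀ y : Fin (n + 1) → ℝ, y (Fin.last n) ≠ 0 → toChart (m.1, y) = m →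
      ∑ a, y a * v.1 a = y (Fin.last n) * tautForm m v := fun y hy h => by
    rw [toChart_eq_iff hy] at h
    rw [sum_base]
    simp only [h, tautForm, mul_sub, Finset.mul_sum]
    rw [sub_eq_neg_add, ← Finset.sum_neg_distrib]
    congr 1
    exact Finset.sum_congr rfl fun i _ => by ring
  constructor
  · intro h
    obtain ⟨y, hy, hym⟩ := exists_toChart_eq m
    have := h y hy hym
    rw [key y hy hym] at this
    exact (mul_eq_zero.mp this).resolve_left hy
  · intro h y hy hym
    rw [key y hy hym, h, mul_zero]

theorem hasFDerivAt_toChart {n : ℕ} (z : Cot n) (hz : z.2 (Fin.last n) ≠ 0) :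
    ∃ L : Cot n →L[ℝ] Chart n, HasFDerivAt toChart L z ∧ ∀ η, L η = (η.1, fun i =>
      -η.2 (Fin.castSucc i) / z.2 (Fin.last n)
        + z.2 (Fin.castSucc i) * η.2 (Fin.last n) / z.2 (Fin.last n) ^ 2) := by
  let Y : Fin (n + 1) → Cot n →L[ℝ] ℝ := fun a =>
    (ContinuousLinearMap.proj (R := ℝ) (φ := fun _ : Fin (n + 1) => ℝ) a).comp
      (ContinuousLinearMap.snd ℝ (Base n) (Fin (n + 1) → ℝ))
  have hY : ∀ a, HasFDerivAt (fun w : Cot n => w.2 a) (Y a) z := fun a => (Y a).hasFDerivAt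
  have hinv := (hasDerivAt_inv hz).comp_hasFDerivAt z (hY (Fin.last n))
  have h2 := fun i : Fin n => (hY (Fin.castSucc i)).fun_neg.fun_mul hinv
  refine ⟨_, (ContinuousLinearMap.fst ℝ (Base n) (Fin (n + 1) → ℝ)).hasFDerivAt.prodMk
    (hasFDerivAt_pi.2 h2), fun η => ?_⟩
  refine Prod.ext rfl (funext fun i => ?_)
  simp [Y]
  field_simp
  ring

theorem fderiv_toChart {n : ℕ} (z η : Cot n) (hz : z.2 (Fin.last n) ≠ 0) :
    fderiv ℝ toChart z η = (η.1, fun i =>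
      -η.2 (Fin.castSucc i) / z.2 (Fin.last n)
        + z.2 (Fin.castSucc i) * η.2 (Fin.last n) / z.2 (Fin.last n) ^ 2) := by
  obtain ⟨L, hL, h⟩ := hasFDerivAt_toChart z hz
  rw [hL.fderiv, h]

/-- On the line through `du - p_i dx^i` the contraction `y_c Γ^c_{ab}` equals `y_{n+1}` times
`contracted Γ`, and the differential of `toChart` divides this factor out. The projected horizontal
space is therefore independent of the chosen `y`. -/
theorem mem_image_horizontal_iff {n : ℕ} (Γ : Christoffel n) {m : Chart n}
    {y : Fin (n + 1) → ℝ} (hy : y (Fin.last n) ≠ 0) (hym : toChart (m.1, y) = m) (ξ : Chart n) :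
    (∃ η ∈ horizontal Γ (m.1, y), fderiv ℝ (toChart (n := n)) (m.1, y) η = ξ) ↔
      ∀ i, ξ.2 i = -∑ b, contracted Γ m (Fin.castSucc i) b * ξ.1 b
        - m.2 i * ∑ b, contracted Γ m (Fin.last n) b * ξ.1 b := by
  rw [toChart_eq_iff hy] at hym
  have hw : ∀ (v : Base n) a, ∑ c, ∑ b, Γ m.1 c a b * y c * v b
      = y (Fin.last n) * ∑ b, contracted Γ m a b * v b := fun v a => by
    rw [Finset.sum_comm, Finset.mul_sum]
    refine Finset.sum_congr rfl fun b _ => ?_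
    rw [sum_base]
    simp only [hym, contracted, sub_mul, mul_sub, Finset.sum_mul, Finset.mul_sum]
    rw [sub_eq_neg_add, ← Finset.sum_neg_distrib]
    congr 1
    · exact Finset.sum_congr rfl fun i _ => by ring
    · ring
  have hd : ∀ η ∈ horizontal Γ (m.1, y), fderiv ℝ (toChart (n := n)) (m.1, y) η
      = (η.1, fun i => -∑ b, contracted Γ m (Fin.castSucc i) b * η.1 b
        - m.2 i * ∑ b, contracted Γ m (Fin.last n) b * η.1 b) := fun η hη => by
    rw [fderiv_toChart _ _ hy]
    refine Prod.ext rfl (funext fun i => ?_)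
    simp only [hη _, hw, hym]
    field_simp
    ring
  constructor
  · rintro ⟨η, hη, rfl⟩ i
    rw [hd η hη]
  · intro h
    refine ⟨(ξ.1, fun a => ∑ c, ∑ b, Γ m.1 c a b * y c * ξ.1 b), fun a => rfl, ?_⟩
    rw [hd _ (fun a => rfl)]
    exact Prod.ext rfl (funext fun i => (h i).symm)

/-- In the combination defining projected horizontal vectors the terms with `Υ_b v^b` cancel, which
leaves `-σ(v) (Υ_i + p_i Υ_{n+1})`. Thus all connections of the class agree exactly on the kernel of
`σ`. -/
theorem contracted_projEquiv {n : ℕ} {Γ Γ' : Christoffel n} {Υ : Base n → Fin (n + 1) → ℝ}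
    {m : Chart n} (h : ∀ c a b, Γ' m.1 c a b
      = Γ m.1 c a b + (if c = a then Υ m.1 b else 0) + (if c = b then Υ m.1 a else 0))
    (v : Chart n) :
    (∀ i, ∑ b, contracted Γ' m (Fin.castSucc i) b * v.1 b
      = ∑ b, contracted Γ m (Fin.castSucc i) b * v.1 b - m.2 i * ∑ b, Υ m.1 b * v.1 b
        + tautForm m v * Υ m.1 (Fin.castSucc i)) ∧
    ∑ b, contracted Γ' m (Fin.last n) b * v.1 b
      = ∑ b, contracted Γ m (Fin.last n) b * v.1 b + ∑ b, Υ m.1 b * v.1 b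
        + tautForm m v * Υ m.1 (Fin.last n) := by
  have hcl : ∀ i : Fin n, Fin.castSucc i ≠ Fin.last n := fun i => (Fin.castSucc_lt_last i).ne
  have hlc : ∀ i : Fin n, Fin.last n ≠ Fin.castSucc i := fun i => (hcl i).symm
  constructor
  · intro i
    simp only [contracted, h, sum_base, tautForm]
    simp [hcl, hlc, mul_add, add_mul, sub_mul, Finset.sum_add_distrib, Finset.mul_sum,
      Finset.sum_mul]
    simp only [mul_assoc, mul_comm, mul_left_comm]
    ring
  · simp only [contracted, h, sum_base, tautForm]
    simp [hcl, hlc, mul_add, add_mul, sub_mul, Finset.sum_add_distrib, 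
      Finset.sum_mul]
    simp only [mul_comm, mul_left_comm]
    ring

/-- Eliminating `du = p_i dx^i` from the horizontality condition is what produces the formula for
`slope`. -/
theorem sum_slope_eq {n : ℕ} {U : Set (Base n)} {Γ : Christoffel n}
    (hΓ : IsTorsionFreeConnection U Γ) {m : Chart n} (hm : m.1 ∈ U) {v : Chart n}
    (hv : tautForm m v = 0) (j : Fin n) :
    ∑ i, slope Γ m i j * v.1 (Fin.castSucc i)
      = -∑ b, contracted Γ m (Fin.castSucc j) b * v.1 b
        - m.2 j * ∑ b, contracted Γ m (Fin.last n) b * v.1 b := by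
  have hu : v.1 (Fin.last n) = ∑ i, m.2 i * v.1 (Fin.castSucc i) := sub_eq_zero.mp hv
  rw [sum_base, sum_base, hu, contracted_symm hΓ hm (Fin.castSucc j) (Fin.last n)]
  simp only [Finset.mul_sum, mul_add, ← Finset.sum_add_distrib, ← Finset.sum_sub_distrib,
    ← Finset.sum_neg_distrib]
  refine Finset.sum_congr rfl fun i _ => ?_
  rw [slope, contracted_symm hΓ hm (Fin.castSucc i) (Fin.castSucc j)]
  ring

theorem mem_lcE_iff {n : ℕ} (hn : 1 ≤ n) {U : Set (Base n)} {Γ : Christoffel n}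
    (hΓ : IsTorsionFreeConnection U Γ) {m : Chart n} (hm : m.1 ∈ U) (v : Chart n) :
    v ∈ lcE U Γ m ↔ tautForm m v = 0 ∧
      ∀ j, v.2 j - ∑ i, slope Γ m i j * v.1 (Fin.castSucc i) = 0 := by
  constructor
  · intro h
    obtain ⟨y, hy, hym⟩ := exists_toChart_eq m
    have h0 := (mem_image_horizontal_iff Γ hy hym v).1 (h Γ ⟨0, fun a => contDiffOn_const,
      fun x _ c a b => by simp⟩ y hy hym)
    -- A single comparison suffices to force `σ(v) = 0`: the connection changed by `Υ = dx^e`, for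
    -- which `Υ_e + p_e Υ_{n+1} = 1`. An index `e` below `n+1` exists because `1 ≤ n`.
    let e : Fin n := ⟨0, hn⟩
    let Υ : Base n → Fin (n + 1) → ℝ := fun _ => Pi.single (Fin.castSucc e) 1
    let Γ' : Christoffel n := fun x c a b => Γ x c a b + (if c = a then Υ x b else 0)
      + (if c = b then Υ x a else 0)
    have h1 := (mem_image_horizontal_iff Γ' hy hym v).1 (h Γ' ⟨Υ, fun a => contDiffOn_const,
      fun x _ c a b => rfl⟩ y hy hym)
    obtain ⟨c1, c2⟩ := contracted_projEquiv (Γ := Γ) (Γ' := Γ') (Υ := Υ) (m := m)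
      (fun _ _ _ => rfl) v
    have h0e := h0 e
    have h1e := h1 e
    have e1 : Υ m.1 (Fin.castSucc e) = 1 := by simp [Υ]
    have e2 : Υ m.1 (Fin.last n) = 0 := by
      simp [Υ, (Fin.castSucc_lt_last e).ne']
    rw [c1, c2, h0e, e1, e2] at h1e
    have hσ : tautForm m v = 0 := by linarith
    refine ⟨hσ, fun j => ?_⟩
    rw [sum_slope_eq hΓ hm hσ, h0 j, sub_self]
  · rintro ⟨hσ, hp⟩ Γ' ⟨Υ, -, hΥ⟩ y hy hym
    rw [mem_image_horizontal_iff Γ' hy hym]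
    intro i
    obtain ⟨c1, c2⟩ := contracted_projEquiv (hΥ m.1 hm) v
    rw [c1, c2, hσ, sub_eq_zero.mp (hp i), sum_slope_eq hΓ hm hσ]
    ring

/-- An adapted gauge of the induced LC structure has the coframe given by `slope Γ`. -/
theorem IsNormalAdaptedGauge.hasCoframe {n : ℕ} (hn : 1 ≤ n) {U : Set (Base n)}
    {Γ : Christoffel n} (hΓ : IsTorsionFreeConnection U Γ) {W : Set (Chart n)}
    (hWU : ∀ m ∈ W, m.1 ∈ U) {A : Chart n → Chart n →ₗ[ℝ] Mat n}
    (hA : IsNormalAdaptedGauge U Γ W A) : HasCoframe (slope Γ) W A := by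
  refine ⟨hA.adapted.sigma, hA.adapted.theta, fun m hm v j => ?_⟩
  obtain ⟨f, -, hf⟩ := hA.adapted.pi m hm
  have key : ∀ i j, f i j = slope Γ m i j := fun i j => by
    -- The vector dual to `θ^i` in the gauge's own coframe lies in `E`, so its `p`-components, which
    -- are `f_{ij}`, must be the slopes.
    have h1 : frameE (fun _ => f) m i ∈ lcE U Γ m := by
      rw [← hA.induces.legendreE m hm]
      refine ⟨?_, fun j => ?_⟩
      · rw [hA.adapted.sigma m hm]
        simp [frameE, Pi.single_apply]
      · rw [hf]
        simp [frameE, Pi.single_apply]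
    have h2 := ((mem_lcE_iff hn hΓ (hWU m hm) _).1 h1).2 j
    simp [frameE, Pi.single_apply] at h2
    linarith
  simp only [hf, key]

/-- A gauge with the coframe given by `slope Γ` is adapted and induces the LC structure. -/
theorem HasCoframe.isNormalAdaptedGauge {n : ℕ} (hn : 1 ≤ n) {U : Set (Base n)}
    {Γ : Christoffel n} (hΓ : IsTorsionFreeConnection U Γ) {W : Set (Chart n)}
    (hWU : ∀ m ∈ W, m.1 ∈ U) {A : Chart n → Chart n →ₗ[ℝ] Mat n}
    (hA : HasCoframe (slope Γ) W A) (hs : ∀ v r s, ContDiffOn ℝ ∞ (fun m => A m v r s) W)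
    (ht : ∀ m ∈ W, ∀ v, (A m v).trace = 0) (hN : IsNormal W A) :
    IsNormalAdaptedGauge U Γ W A := by
  refine ⟨⟨hs, ht, fun m hm v hv => ?_⟩, hN, ⟨fun m hm => ?_, fun m hm => ?_, fun m hm => ?_⟩,
    ⟨hA.sigma, hA.theta, fun m hm => ⟨slope Γ m, slope_symm hΓ (hWU m hm), hA.pi m hm⟩⟩⟩
  · obtain ⟨h1, h2, h3⟩ := (isBlockUpper_iff _).1 hv
    have e3 := hA.sigma m hm v
    have e2 := fun j => hA.pi m hm v j
    simp only [hA.theta m hm] at h1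
    simp only [h1, h2, h3, mul_zero, Finset.sum_const_zero, sub_zero] at e2 e3
    exact Prod.ext (funext fun a => Fin.lastCases e3.symm h1 a) (funext fun j => (e2 j).symm)
  · ext v
    rw [mem_lcD_iff, Set.mem_ofPred_eq, hA.sigma m hm, tautForm]
  · ext v
    rw [mem_lcE_iff hn hΓ (hWU m hm), Set.mem_ofPred_eq, hA.sigma m hm, tautForm]
    simp only [hA.pi m hm]
  · ext v
    simp only [Set.mem_ofPred_eq, hA.sigma m hm, hA.theta m hm, lcF]
    constructor
    · rintro ⟨h1, h2⟩
      simp only [h2, mul_zero, Finset.sum_const_zero, sub_zero] at h1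
      exact funext fun a => Fin.lastCases h1 h2 a
    · intro h
      simp [h]

/-! ### The normal projective gauge on the base -/

/-- The projective Schouten tensor of a trace-free representative. -/
def schouten {n : ℕ} (Γ : Christoffel n) (x : Base n) (b c : Fin (n + 1)) : ℝ :=
  (1 / n : ℝ) * (-∑ a, fderiv ℝ (fun x' => Γ x' a b c) x (Pi.single a 1)
    + ∑ a, ∑ e, Γ x a e c * Γ x e b a)

/-- The matrix with blocks `0`, `P_{bc} ξ^c`, `ξ^a`, `Γ^a_{bc} ξ^c`. -/
def projGauge {n : ℕ} (Γ : Christoffel n) (x : Base n) : Base n →ₗ[ℝ] Mat n where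
  toFun ξ := Matrix.of fun r s =>
    Fin.cases (Fin.cases 0 (fun b => ∑ c, schouten Γ x b c * ξ c) s)
      (fun a => Fin.cases (ξ a) (fun b => ∑ c, Γ x a b c * ξ c) s) r
  map_add' ξ η := by
    ext r s
    refine Fin.cases ?_ (fun a => ?_) r <;> refine Fin.cases ?_ (fun b => ?_) s <;>
      simp [mul_add, Finset.sum_add_distrib]
  map_smul' t ξ := by
    ext r s
    refine Fin.cases ?_ (fun a => ?_) r <;> refine Fin.cases ?_ (fun b => ?_) s <;>
      simp [Finset.mul_sum, mul_left_comm]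

section entries
variable {n : ℕ} (Γ : Christoffel n) (x ξ : Base n) (a b : Fin (n + 1))

@[simp] theorem projGauge_zero_zero : projGauge Γ x ξ 0 0 = 0 := rfl
@[simp] theorem projGauge_zero_succ :
    projGauge Γ x ξ 0 b.succ = ∑ c, schouten Γ x b c * ξ c := rfl
@[simp] theorem projGauge_succ_zero : projGauge Γ x ξ a.succ 0 = ξ a := rfl
@[simp] theorem projGauge_succ_succ :
    projGauge Γ x ξ a.succ b.succ = ∑ c, Γ x a b c * ξ c := rfl
end entries

/-- The curvature of the projective gauge. -/
def projCurv {n : ℕ} (Γ : Christoffel n) (x ξ η : Base n) : Mat n :=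
  Matrix.of (fun r s => fderiv ℝ (fun x' => projGauge Γ x' η r s) x ξ
      - fderiv ℝ (fun x' => projGauge Γ x' ξ r s) x η)
    + (projGauge Γ x ξ * projGauge Γ x η - projGauge Γ x η * projGauge Γ x ξ)

section proj
variable {n : ℕ} {U : Set (Base n)} (hU : IsOpen U) {Γ : Christoffel n}
  (hΓ : IsTorsionFreeConnection U Γ)
include hU hΓ

theorem contDiffOn_schouten (b c : Fin (n + 1)) :
    ContDiffOn ℝ ∞ (fun x => schouten Γ x b c) U := by
  unfold schouten
  refine contDiffOn_const.mul (ContDiffOn.add (ContDiffOn.neg (ContDiffOn.sum fun a _ => ?_))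
    (ContDiffOn.sum fun a _ => ContDiffOn.sum fun e _ => (hΓ.smooth _ _ _).mul (hΓ.smooth _ _ _)))
  exact ((hΓ.smooth a b c).fderiv_of_isOpen hU (by simp)).clm_apply contDiffOn_const

theorem contDiffOn_projGauge (ξ : Base n) (r s : Fin (n + 2)) :
    ContDiffOn ℝ ∞ (fun x => projGauge Γ x ξ r s) U := by
  refine Fin.cases ?_ (fun a => ?_) r <;> refine Fin.cases ?_ (fun b => ?_) s
  · exact contDiffOn_const
  · simp only [projGauge_zero_succ]
    exact ContDiffOn.sum fun c _ => (contDiffOn_schouten hU hΓ b c).mul contDiffOn_const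
  · exact contDiffOn_const
  · simp only [projGauge_succ_succ]
    exact ContDiffOn.sum fun c _ => (hΓ.smooth a b c).mul contDiffOn_const

theorem differentiableAt_projGauge {x : Base n} (hx : x ∈ U) (ξ : Base n) (r s : Fin (n + 2)) :
    DifferentiableAt ℝ (fun x => projGauge Γ x ξ r s) x :=
  ((contDiffOn_projGauge hU hΓ ξ r s).contDiffAt (hU.mem_nhds hx)).differentiableAt (by simp)

theorem projCurv_add_left {x : Base n} (hx : x ∈ U) (ξ ξ' η : Base n) :
    projCurv Γ x (ξ + ξ') η = projCurv Γ x ξ η + projCurv Γ x ξ' η := by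
  have h : ∀ r s, fderiv ℝ (fun x' => projGauge Γ x' (ξ + ξ') r s) x
      = fderiv ℝ (fun x' => projGauge Γ x' ξ r s) x
        + fderiv ℝ (fun x' => projGauge Γ x' ξ' r s) x := fun r s => by
    rw [← fderiv_fun_add (differentiableAt_projGauge hU hΓ hx _ _ _)
      (differentiableAt_projGauge hU hΓ hx _ _ _)]
    simp only [map_add, Matrix.add_apply]
  ext r s
  simp only [projCurv, Matrix.add_apply, Matrix.of_apply, h]
  simp only [map_add, add_mul, mul_add, Matrix.add_apply, Matrix.sub_apply, _root_.add_apply]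
  ring

theorem projCurv_smul_left {x : Base n} (hx : x ∈ U) (t : ℝ) (ξ η : Base n) :
    projCurv Γ x (t • ξ) η = t • projCurv Γ x ξ η := by
  have h : ∀ r s, fderiv ℝ (fun x' => projGauge Γ x' (t • ξ) r s) x
      = t • fderiv ℝ (fun x' => projGauge Γ x' ξ r s) x := fun r s => by
    rw [← fderiv_fun_const_smul (differentiableAt_projGauge hU hΓ hx _ _ _)]
    simp only [map_smul, Matrix.smul_apply]
  ext r s
  simp only [projCurv, Matrix.add_apply, Matrix.of_apply, Matrix.smul_apply, h]
  simp
  ring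

omit hU hΓ in
theorem projCurv_swap (x ξ η : Base n) : projCurv Γ x η ξ = -projCurv Γ x ξ η := by
  ext r s
  simp only [projCurv, Matrix.add_apply, Matrix.of_apply, Matrix.sub_apply, Matrix.neg_apply]
  ring

theorem projCurv_add_right {x : Base n} (hx : x ∈ U) (ξ η η' : Base n) :
    projCurv Γ x ξ (η + η') = projCurv Γ x ξ η + projCurv Γ x ξ η' := by
  rw [projCurv_swap, projCurv_add_left hU hΓ hx, neg_add, ← projCurv_swap, ← projCurv_swap]

theorem projCurv_smul_right {x : Base n} (hx : x ∈ U) (t : ℝ) (ξ η : Base n) :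
    projCurv Γ x ξ (t • η) = t • projCurv Γ x ξ η := by
  rw [projCurv_swap, projCurv_smul_left hU hΓ hx, ← smul_neg, ← projCurv_swap]

theorem schouten_symm {x : Base n} (hx : x ∈ U) (b c : Fin (n + 1)) :
    schouten Γ x b c = schouten Γ x c b := by
  have h : ∀ a, fderiv ℝ (fun x' => Γ x' a b c) x = fderiv ℝ (fun x' => Γ x' a c b) x := fun a =>
    Filter.EventuallyEq.fderiv_eq (by
      filter_upwards [hU.mem_nhds hx] with x' hx' using hΓ.symm x' hx' a b c)
  have h2 : ∑ a, ∑ e, Γ x a e c * Γ x e b a = ∑ a, ∑ e, Γ x a e b * Γ x e c a := by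
    rw [Finset.sum_comm]
    refine Finset.sum_congr rfl fun a _ => Finset.sum_congr rfl fun e _ => ?_
    rw [hΓ.symm x hx e a c, hΓ.symm x hx a b e, mul_comm]
  simp only [schouten, h, h2]

/-- Vanishing torsion and symmetry of the Schouten tensor. -/
theorem projCurv_apply_zero {x : Base n} (hx : x ∈ U) (ξ η : Base n) (r : Fin (n + 2)) :
    projCurv Γ x ξ η r 0 = 0 := by
  refine Fin.cases ?_ (fun a => ?_) r
  · simp only [projCurv, Matrix.add_apply, Matrix.of_apply, Matrix.sub_apply, Matrix.mul_apply,
      Fin.sum_univ_succ (n := n + 1), projGauge_zero_zero, projGauge_zero_succ,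
      projGauge_succ_zero, Finset.sum_mul]
    rw [Finset.sum_comm]
    simp [schouten_symm hU hΓ hx, mul_right_comm]
  · simp only [projCurv, Matrix.add_apply, Matrix.of_apply, Matrix.sub_apply, Matrix.mul_apply,
      Fin.sum_univ_succ (n := n + 1), projGauge_zero_zero, projGauge_succ_succ,
      projGauge_succ_zero, Finset.sum_mul]
    rw [Finset.sum_comm]
    simp
    rw [sub_eq_zero]
    refine Finset.sum_congr rfl fun y _ => Finset.sum_congr rfl fun z _ => ?_
    rw [hΓ.symm x hx a z y]
    ring

/-- The Ricci-type contraction of the projective curvature vanishes. -/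
theorem sum_projCurv_single (hn : 1 ≤ n) (hΓtr : ∀ x ∈ U, ∀ c, ∑ a, Γ x a a c = 0)
    {x : Base n} (hx : x ∈ U) (ξ : Base n) (s : Fin (n + 2)) :
    ∑ a, projCurv Γ x ξ (Pi.single a 1) a.succ s = 0 := by
  refine Fin.cases ?_ (fun b => ?_) s
  · simp [projCurv_apply_zero hU hΓ hx]
  have hn0 : (n : ℝ) ≠ 0 := by positivity
  have hd : ∀ a b c, DifferentiableAt ℝ (fun x' => Γ x' a b c) x := fun a b c =>
    ((hΓ.smooth a b c).contDiffAt (hU.mem_nhds hx)).differentiableAt (by simp)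
  have hder : ∀ a (ζ v : Base n), fderiv ℝ (fun x' => projGauge Γ x' ζ a.succ b.succ) x v
      = ∑ c, fderiv ℝ (fun x' => Γ x' a b c) x v * ζ c := fun a ζ v => by
    simp only [projGauge_succ_succ]
    rw [fderiv_fun_sum fun c _ => (hd a b c).mul_const _]
    simp [fderiv_mul_const (hd a b _), mul_comm]
  have htr' : ∀ x ∈ U, ∀ b, ∑ a, Γ x a b a = 0 := fun x hx b => by
    rw [← hΓtr x hx b]
    exact Finset.sum_congr rfl fun a _ => hΓ.symm x hx a b a
  have htrd : ∑ a, fderiv ℝ (fun x' => Γ x' a b a) x ξ = 0 := by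
    have e : fderiv ℝ (fun x' => ∑ a, Γ x' a b a) x = fderiv ℝ (fun _ => (0 : ℝ)) x :=
      Filter.EventuallyEq.fderiv_eq (by
        filter_upwards [hU.mem_nhds hx] with x' hx' using htr' x' hx' b)
    rw [fderiv_fun_sum fun a _ => hd a b a] at e
    have := congrArg (fun L => L ξ) e
    simpa using this
  -- In the contraction the Schouten term occurs once with a plus sign and `n+1` times with a minus
  -- sign. The net factor `-n` explains the normalization `1/n` in `schouten`.
  have hP : n * ∑ c, schouten Γ x b c * ξ c
      = -∑ a, ∑ c, fderiv ℝ (fun x' => Γ x' a b c) x (Pi.single a 1) * ξ c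
        + ∑ a, ∑ e, (∑ c, Γ x a e c * ξ c) * Γ x e b a := by
    have e1 : ∑ a, ∑ e, (∑ c, Γ x a e c * ξ c) * Γ x e b a
        = ∑ c, (∑ a, ∑ e, Γ x a e c * Γ x e b a) * ξ c := by
      simp only [Finset.sum_mul]
      refine Eq.trans ?_ Finset.sum_comm
      refine Finset.sum_congr rfl fun a _ => ?_
      rw [Finset.sum_comm]
      exact Finset.sum_congr rfl fun c _ => Finset.sum_congr rfl fun e _ => by ring
    rw [e1, Finset.sum_comm, ← Finset.sum_neg_distrib, ← Finset.sum_add_distrib, Finset.mul_sum]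
    refine Finset.sum_congr rfl fun c _ => ?_
    rw [schouten, ← Finset.sum_mul]
    field_simp
  -- Together with `htrd`, this removes the parts of the Ricci tensor that involve the trace of `Γ`;
  -- `schouten` omits them.
  have hT : ∑ a, ∑ e, Γ x a e a * ∑ c, Γ x e b c * ξ c = 0 := by
    rw [Finset.sum_comm]
    simp [← Finset.sum_mul, htr' x hx]
  simp only [projCurv, Matrix.add_apply, Matrix.of_apply, Matrix.sub_apply, hder]
  simp only [Matrix.mul_apply, Fin.sum_univ_succ (n := n + 1), projGauge_succ_succ,
    projGauge_zero_succ, projGauge_succ_zero]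
  simp [Pi.single_apply, Finset.sum_add_distrib, Finset.sum_sub_distrib, hT,
    htrd, mul_comm (ξ _)]
  linarith

end proj

/-! ### Gauge transformations -/

theorem two_le_infty : (2 : WithTop ℕ∞) ≤ ∞ :=
  WithTop.coe_le_coe.2 (le_top : (2 : ℕ∞) ≤ ⊤)

/-- The entrywise derivative of a matrix-valued function. -/
def matDeriv {n : ℕ} (F : Chart n → Mat n) (m v : Chart n) : Mat n :=
  Matrix.of fun r s => fderiv ℝ (fun m' => F m' r s) m v

theorem matDeriv_mul {n : ℕ} {F G : Chart n → Mat n} {m : Chart n}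
    (hF : ∀ r s, DifferentiableAt ℝ (fun m' => F m' r s) m)
    (hG : ∀ r s, DifferentiableAt ℝ (fun m' => G m' r s) m) (v : Chart n) :
    matDeriv (fun m' => F m' * G m') m v = matDeriv F m v * G m + F m * matDeriv G m v := by
  ext r s
  simp only [matDeriv, Matrix.of_apply, Matrix.mul_apply, Matrix.add_apply]
  rw [fderiv_fun_sum fun k _ => (hF r k).fun_mul (hG k s)]
  simp only [fderiv_fun_mul (hF r _) (hG _ s)]
  simp [Finset.sum_add_distrib, mul_comm, add_comm]

theorem matDeriv_add {n : ℕ} {F G : Chart n → Mat n} {m : Chart n}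
    (hF : ∀ r s, DifferentiableAt ℝ (fun m' => F m' r s) m)
    (hG : ∀ r s, DifferentiableAt ℝ (fun m' => G m' r s) m) (v : Chart n) :
    matDeriv (fun m' => F m' + G m') m v = matDeriv F m v + matDeriv G m v := by
  ext r s
  simp only [matDeriv, Matrix.of_apply, Matrix.add_apply]
  rw [fderiv_fun_add (hF r s) (hG r s), _root_.add_apply]

theorem matDeriv_const_add {n : ℕ} {F : Chart n → Mat n} {m : Chart n} (C : Mat n)
    (v : Chart n) : matDeriv (fun m' => C + F m') m v = matDeriv F m v := by
  ext r s
  simp [matDeriv]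

theorem matDeriv_const_sub {n : ℕ} {F : Chart n → Mat n} {m : Chart n} (C : Mat n)
    (v : Chart n) : matDeriv (fun m' => C - F m') m v = -matDeriv F m v := by
  ext r s
  simp [matDeriv, fderiv_const_sub]

theorem gaugeCurvature_eq {n : ℕ} (A : Chart n → Chart n →ₗ[ℝ] Mat n) (m v w : Chart n) :
    gaugeCurvature A m v w = matDeriv (fun m' => A m' w) m v - matDeriv (fun m' => A m' v) m w
      + (A m v * A m w - A m w * A m v) := rfl

theorem differentiableAt_mul_entry {n : ℕ} {F G : Chart n → Mat n} {m : Chart n}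
    (hF : ∀ r s, DifferentiableAt ℝ (fun m' => F m' r s) m)
    (hG : ∀ r s, DifferentiableAt ℝ (fun m' => G m' r s) m) (r s : Fin (n + 2)) :
    DifferentiableAt ℝ (fun m' => (F m' * G m') r s) m := by
  simp only [Matrix.mul_apply]
  exact DifferentiableAt.fun_sum fun k _ => (hF r k).fun_mul (hG k s)

/-- The transform of `A` by `1 + N`, when `N` and its derivatives have vanishing products. -/
def unipotentTransform {n : ℕ} (N : Chart n → Mat n) (A : Chart n → Chart n →ₗ[ℝ] Mat n)
    (m : Chart n) : Chart n →ₗ[ℝ] Mat n where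
  toFun v := (1 - N m) * A m v * (1 + N m) + matDeriv N m v
  map_add' v w := by
    ext r s
    simp only [map_add, mul_add, add_mul, Matrix.add_apply, matDeriv, Matrix.of_apply]
    ring
  map_smul' t v := by
    ext r s
    simp [matDeriv, mul_add]

theorem unipotentTransform_apply {n : ℕ} (N : Chart n → Mat n)
    (A : Chart n → Chart n →ₗ[ℝ] Mat n) (m v : Chart n) :
    unipotentTransform N A m v = (1 - N m) * A m v * (1 + N m) + matDeriv N m v := rfl

/-- Matrices supported in the middle columns and the outer rows. -/
def IsOuterMiddle {n : ℕ} (M : Mat n) : Prop :=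
  (∀ i s, M (mid i) s = 0) ∧ ∀ r, M r 0 = 0 ∧ M r (Fin.last (n + 1)) = 0

theorem IsOuterMiddle.mul_eq_zero {n : ℕ} {M M' : Mat n} (h : IsOuterMiddle M)
    (h' : IsOuterMiddle M') : M * M' = 0 := by
  ext r s
  simp [Matrix.mul_apply, sum_blocks (n := n), h.2, h'.1]

theorem IsOuterMiddle.matDeriv {n : ℕ} {N : Chart n → Mat n} (h : ∀ m, IsOuterMiddle (N m))
    (m v : Chart n) : IsOuterMiddle (matDeriv N m v) := by
  simp [IsOuterMiddle, LCFefferman.matDeriv, fun m => (h m).1, fun m r => ((h m).2 r).1,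
    fun m r => ((h m).2 r).2]

/-- The ring identity behind gauge covariance of the curvature: `a`, `b` stand for `dN` on two
vectors, `c` for the symmetric second derivative, `dX`, `dY` for derivatives of the gauge. All
vanishing products say that `1 - N` inverts `1 + N` and that `(1 + N)⁻¹ dN = dN`. -/
theorem transform_algebra {R : Type*} [Ring R] {N a b c X Y dX dY : R} (hNN : N * N = 0)
    (hNa : N * a = 0) (hNb : N * b = 0) (haN : a * N = 0) (hbN : b * N = 0) (hab : a * b = 0)
    (hba : b * a = 0) :
    ((-a * Y + (1 - N) * dY) * (1 + N) + (1 - N) * Y * a + c)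
      - ((-b * X + (1 - N) * dX) * (1 + N) + (1 - N) * X * b + c)
      + (((1 - N) * X * (1 + N) + a) * ((1 - N) * Y * (1 + N) + b)
        - ((1 - N) * Y * (1 + N) + b) * ((1 - N) * X * (1 + N) + a))
      = (1 - N) * (dY - dX + (X * Y - Y * X)) * (1 + N) := by
  have h1 : (1 + N) * (1 - N) = 1 := by
    have : (1 + N) * (1 - N) = 1 - N * N := by noncomm_ring
    rw [this, hNN, sub_zero]
  have h2 : ∀ X Y a b : R, (1 + N) * b = b → a * (1 - N) = a → a * b = 0 →
      ((1 - N) * X * (1 + N) + a) * ((1 - N) * Y * (1 + N) + b)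
      = (1 - N) * X * Y * (1 + N) + (1 - N) * X * b + a * Y * (1 + N) := fun X Y a b e1 e2 e3 => by
    calc _ = (1 - N) * X * ((1 + N) * (1 - N)) * Y * (1 + N) + (1 - N) * X * ((1 + N) * b)
          + (a * (1 - N)) * Y * (1 + N) + a * b := by noncomm_ring
      _ = _ := by rw [h1, e1, e2, e3, mul_one, add_zero]
  rw [h2 X Y a b (by rw [add_mul, hNb, one_mul, add_zero]) (by rw [mul_sub, haN, mul_one, sub_zero])
    hab, h2 Y X b a (by rw [add_mul, hNa, one_mul, add_zero])
    (by rw [mul_sub, hbN, mul_one, sub_zero]) hba]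
  noncomm_ring

/-- Curvature is conjugated under a change of gauge. The second derivatives of `N` drop out by
symmetry, and the rest is `transform_algebra`. -/
theorem gaugeCurvature_unipotentTransform {n : ℕ} {N : Chart n → Mat n}
    {A : Chart n → Chart n →ₗ[ℝ] Mat n} {m : Chart n} (hN : ∀ m, IsOuterMiddle (N m))
    (hNd : ∀ r s, ContDiffAt ℝ ∞ (fun m' => N m' r s) m)
    (hA : ∀ v r s, DifferentiableAt ℝ (fun m' => A m' v r s) m) (v w : Chart n) :
    gaugeCurvature (unipotentTransform N A) m v w
      = (1 - N m) * gaugeCurvature A m v w * (1 + N m) := by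
  have hN1 : ∀ r s, DifferentiableAt ℝ (fun m' => N m' r s) m := fun r s =>
    (hNd r s).differentiableAt (by simp)
  have hNm : ∀ r s, DifferentiableAt ℝ (fun m' => (1 - N m') r s) m := fun r s =>
    (differentiableAt_const _).fun_sub (hN1 r s)
  have hNp : ∀ r s, DifferentiableAt ℝ (fun m' => (1 + N m') r s) m := fun r s =>
    (differentiableAt_const _).fun_add (hN1 r s)
  have hdd : ∀ v r s, DifferentiableAt ℝ (fun m' => matDeriv N m' v r s) m := fun v r s => by
    simp only [matDeriv, Matrix.of_apply]
    exact (((hNd r s).fderiv_right (m := 1) (one_add_one_eq_two.trans_le two_le_infty)).differentiableAt (by simp)).clm_apply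
      (differentiableAt_const _)
  have hsymm : matDeriv (fun m' => matDeriv N m' v) m w
      = matDeriv (fun m' => matDeriv N m' w) m v := by
    ext r s
    simp only [matDeriv, Matrix.of_apply]
    have hf := ((hNd r s).fderiv_right (m := 1) (one_add_one_eq_two.trans_le two_le_infty)).differentiableAt (by simp)
    have hs := (hNd r s).isSymmSndFDerivAt
      (by rw [minSmoothness_of_isRCLikeNormedField]; exact two_le_infty)
    rw [fderiv_clm_apply hf (differentiableAt_const _),
      fderiv_clm_apply hf (differentiableAt_const _)]
    simpa using hs w v
  have hder : ∀ v w, matDeriv (fun m' => unipotentTransform N A m' w) m v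
      = (-matDeriv N m v * A m w + (1 - N m) * matDeriv (fun m' => A m' w) m v) * (1 + N m)
        + (1 - N m) * A m w * matDeriv N m v + matDeriv (fun m' => matDeriv N m' w) m v :=
      fun v w => by
    simp only [unipotentTransform_apply]
    rw [matDeriv_add (differentiableAt_mul_entry (differentiableAt_mul_entry hNm (hA w)) hNp)
      (hdd w), matDeriv_mul (differentiableAt_mul_entry hNm (hA w)) hNp,
      matDeriv_mul hNm (hA w), matDeriv_const_add, matDeriv_const_sub]
  rw [gaugeCurvature_eq, gaugeCurvature_eq, hder, hder, hsymm]
  simp only [unipotentTransform_apply]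
  have hd := IsOuterMiddle.matDeriv hN m
  exact transform_algebra ((hN m).mul_eq_zero (hN m)) ((hN m).mul_eq_zero (hd v))
    ((hN m).mul_eq_zero (hd w)) ((hd v).mul_eq_zero (hN m)) ((hd w).mul_eq_zero (hN m))
    ((hd v).mul_eq_zero (hd w)) ((hd w).mul_eq_zero (hd v))

/-! ### The normal adapted gauge -/

/-- The unipotent matrix (minus `1`) carrying the projective gauge to an adapted one. -/
def tilt {n : ℕ} (Γ : Christoffel n) (m : Chart n) : Mat n :=
  -- The last row turns `dx^{n+1}` into `σ` and, through its derivative, contributes `dp_j` to the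
  -- bottom middle block. The row `0` is chosen to cancel the `dx^{n+1}`-component left in that
  -- block, so that it becomes `dp_j - f_{ij} dx^i`.
  Matrix.of fun r s => ∑ j, if s = mid j then
    (if r = 0 then -(contracted Γ m (Fin.castSucc j) (Fin.last n)
      + m.2 j * contracted Γ m (Fin.last n) (Fin.last n))
    else if r = Fin.last (n + 1) then m.2 j else 0) else 0

section tilt
variable {n : ℕ} (Γ : Christoffel n) (m : Chart n)

theorem tilt_zero_mid (j : Fin n) : tilt Γ m 0 (mid j)
    = -(contracted Γ m (Fin.castSucc j) (Fin.last n)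
      + m.2 j * contracted Γ m (Fin.last n) (Fin.last n)) := by
  simp [tilt]

theorem tilt_last_mid (j : Fin n) : tilt Γ m (Fin.last (n + 1)) (mid j) = m.2 j := by
  simp [tilt]

theorem isOuterMiddle_tilt : IsOuterMiddle (tilt Γ m) := by
  simp [IsOuterMiddle, tilt]

theorem one_sub_tilt_mul_mid (X : Mat n) (i : Fin n) (s : Fin (n + 2)) :
    ((1 - tilt Γ m) * X) (mid i) s = X (mid i) s := by
  rw [sub_mul, one_mul, Matrix.sub_apply]
  simp [Matrix.mul_apply, (isOuterMiddle_tilt Γ m).1]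

theorem one_sub_tilt_mul_last (X : Mat n) (s : Fin (n + 2)) :
    ((1 - tilt Γ m) * X) (Fin.last (n + 1)) s
      = X (Fin.last (n + 1)) s - ∑ j, m.2 j * X (mid j) s := by
  rw [sub_mul, one_mul, Matrix.sub_apply]
  simp [Matrix.mul_apply, sum_blocks (n := n), (isOuterMiddle_tilt Γ m).2,
    tilt_last_mid]

theorem one_sub_tilt_mul_zero (X : Mat n) (s : Fin (n + 2)) :
    ((1 - tilt Γ m) * X) 0 s = X 0 s - ∑ j, tilt Γ m 0 (mid j) * X (mid j) s := by
  rw [sub_mul, one_mul, Matrix.sub_apply]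
  simp [Matrix.mul_apply, sum_blocks (n := n), (isOuterMiddle_tilt Γ m).2]

theorem mul_one_add_tilt_zero (X : Mat n) (r : Fin (n + 2)) :
    (X * (1 + tilt Γ m)) r 0 = X r 0 := by
  rw [mul_add, mul_one, Matrix.add_apply]
  simp [Matrix.mul_apply, (isOuterMiddle_tilt Γ m).2]

theorem mul_one_add_tilt_last (X : Mat n) (r : Fin (n + 2)) :
    (X * (1 + tilt Γ m)) r (Fin.last (n + 1)) = X r (Fin.last (n + 1)) := by
  rw [mul_add, mul_one, Matrix.add_apply]
  simp [Matrix.mul_apply, (isOuterMiddle_tilt Γ m).2]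

theorem mul_one_add_tilt_mid (X : Mat n) (r : Fin (n + 2)) (j : Fin n) :
    (X * (1 + tilt Γ m)) r (mid j) = X r (mid j) + X r 0 * tilt Γ m 0 (mid j)
      + X r (Fin.last (n + 1)) * m.2 j := by
  rw [mul_add, mul_one, Matrix.add_apply]
  simp [Matrix.mul_apply, sum_blocks (n := n), (isOuterMiddle_tilt Γ m).1,
    tilt_last_mid, add_assoc]

end tilt

/-- The projective gauge as a gauge on the chart. -/
def pullbackGauge {n : ℕ} (Γ : Christoffel n) (m : Chart n) : Chart n →ₗ[ℝ] Mat n :=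
  (projGauge Γ m.1).comp (LinearMap.fst ℝ (Base n) (Fin n → ℝ))

/-- The normal adapted gauge of the projective class of a trace-free connection. -/
def normalGauge {n : ℕ} (Γ : Christoffel n) : Chart n → Chart n →ₗ[ℝ] Mat n :=
  unipotentTransform (tilt Γ) (pullbackGauge Γ)

theorem projGauge_mid_zero {n : ℕ} (Γ : Christoffel n) (x ξ : Base n) (i : Fin n) :
    projGauge Γ x ξ (mid i) 0 = ξ (Fin.castSucc i) := rfl

theorem projGauge_last_zero {n : ℕ} (Γ : Christoffel n) (x ξ : Base n) :
    projGauge Γ x ξ (Fin.last (n + 1)) 0 = ξ (Fin.last n) := rfl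

theorem projGauge_contracted {n : ℕ} (Γ : Christoffel n) (m v : Chart n) (b : Fin (n + 1)) :
    projGauge Γ m.1 v.1 (Fin.last (n + 1)) b.succ
      - ∑ j, m.2 j * projGauge Γ m.1 v.1 (mid j) b.succ = ∑ c, contracted Γ m b c * v.1 c := by
  have h1 : projGauge Γ m.1 v.1 (Fin.last (n + 1)) b.succ
      = ∑ c, Γ m.1 (Fin.last n) b c * v.1 c := rfl
  have h2 : ∀ j : Fin n, projGauge Γ m.1 v.1 (mid j) b.succ
      = ∑ c, Γ m.1 (Fin.castSucc j) b c * v.1 c := fun j => rfl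
  simp only [h1, h2, contracted, sub_mul, Finset.sum_sub_distrib, Finset.mul_sum, Finset.sum_mul]
  rw [Finset.sum_comm]
  simp only [mul_assoc]

section gauge
variable {n : ℕ} {U : Set (Base n)} (hU : IsOpen U) {Γ : Christoffel n}
  (hΓ : IsTorsionFreeConnection U Γ) {W : Set (Chart n)} (hW : IsOpen W)
  (hWU : ∀ m ∈ W, m.1 ∈ U)

theorem matDeriv_tilt_last_mid (m v : Chart n) (j : Fin n) :
    matDeriv (tilt Γ) m v (Fin.last (n + 1)) (mid j) = v.2 j := by
  simp only [matDeriv, Matrix.of_apply, tilt_last_mid]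
  exact congrArg (fun L => L v) (((ContinuousLinearMap.proj (R := ℝ) (φ := fun _ : Fin n => ℝ)
    j).comp (ContinuousLinearMap.snd ℝ (Base n) (Fin n → ℝ))).hasFDerivAt (x := m)).fderiv

/-- The term `matDeriv` and right multiplication by `1 + tilt Γ m` do not touch the outer columns,
so only left multiplication contributes. This value becomes the coefficient of `σ` in the Fefferman
metric. -/
theorem normalGauge_corners (m v : Chart n) :
    normalGauge Γ m v 0 0 + normalGauge Γ m v (Fin.last (n + 1)) (Fin.last (n + 1))
      = ∑ j, (contracted Γ m (Fin.castSucc j) (Fin.last n)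
          + m.2 j * contracted Γ m (Fin.last n) (Fin.last n)) * v.1 (Fin.castSucc j)
        + ∑ c, contracted Γ m (Fin.last n) c * v.1 c := by
  have hD := IsOuterMiddle.matDeriv (isOuterMiddle_tilt Γ) m v
  rw [← projGauge_contracted, Fin.succ_last]
  simp only [normalGauge, unipotentTransform_apply, Matrix.add_apply, (hD.2 _).1, (hD.2 _).2,
    mul_one_add_tilt_zero, mul_one_add_tilt_last, one_sub_tilt_mul_zero, one_sub_tilt_mul_last,
    tilt_zero_mid, pullbackGauge, LinearMap.comp_apply, LinearMap.fst_apply, projGauge_mid_zero,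
    projGauge_zero_zero]
  simp only [neg_mul, Finset.sum_neg_distrib]
  ring

include hΓ hWU in
theorem hasCoframe_normalGauge : HasCoframe (slope Γ) W (normalGauge Γ) := by
  refine ⟨fun m hm v => ?_, fun m hm v i => ?_, fun m hm v j => ?_⟩
  · have hD := IsOuterMiddle.matDeriv (isOuterMiddle_tilt Γ) m v
    simp [normalGauge, unipotentTransform_apply, (hD.2 _).1, mul_one_add_tilt_zero,
      one_sub_tilt_mul_last, pullbackGauge, projGauge_mid_zero, projGauge_last_zero]
  · have hD := IsOuterMiddle.matDeriv (isOuterMiddle_tilt Γ) m v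
    simp [normalGauge, unipotentTransform_apply, (hD.2 _).1, mul_one_add_tilt_zero,
      one_sub_tilt_mul_mid, pullbackGauge, projGauge_mid_zero]
  · have e1 := projGauge_contracted Γ m v (Fin.castSucc j)
    have e2 := projGauge_contracted Γ m v (Fin.last n)
    rw [Fin.succ_last] at e2
    change _ - ∑ k, m.2 k * projGauge Γ m.1 v.1 (mid k) (mid j) = _ at e1
    change projGauge Γ m.1 v.1 (Fin.last (n + 1)) (mid j) - _ = _ at e1
    simp only [normalGauge, unipotentTransform_apply, Matrix.add_apply, matDeriv_tilt_last_mid,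
      mul_one_add_tilt_mid, one_sub_tilt_mul_last, pullbackGauge, LinearMap.comp_apply,
      LinearMap.fst_apply, projGauge_mid_zero, projGauge_last_zero, e1, e2, tilt_zero_mid]
    rw [sum_base, sum_base]
    have e3 : ∑ i, slope Γ m i j * v.1 (Fin.castSucc i)
        = -∑ i, contracted Γ m (Fin.castSucc j) (Fin.castSucc i) * v.1 (Fin.castSucc i)
          - (∑ i, m.2 i * v.1 (Fin.castSucc i)) * (contracted Γ m (Fin.castSucc j) (Fin.last n)
            + m.2 j * contracted Γ m (Fin.last n) (Fin.last n))
          - (∑ i, contracted Γ m (Fin.last n) (Fin.castSucc i) * v.1 (Fin.castSucc i))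
            * m.2 j := by
      rw [Finset.sum_mul, Finset.sum_mul, ← Finset.sum_neg_distrib, ← Finset.sum_sub_distrib,
        ← Finset.sum_sub_distrib]
      refine Finset.sum_congr rfl fun i _ => ?_
      rw [slope, contracted_symm hΓ (hWU m hm) (Fin.castSucc i) (Fin.castSucc j),
        contracted_symm hΓ (hWU m hm) (Fin.last n) (Fin.castSucc j)]
      ring
    rw [e3]
    ring

include hΓ hWU in
theorem contDiffOn_tilt (r s : Fin (n + 2)) : ContDiffOn ℝ ∞ (fun m => tilt Γ m r s) W := by
  have hp : ∀ j : Fin n, ContDiffOn ℝ ∞ (fun m : Chart n => m.2 j) W := fun j => by fun_prop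
  have hG : ∀ a b, ContDiffOn ℝ ∞ (fun m => contracted Γ m a b) W := fun a b => by
    have hc : ∀ c, ContDiffOn ℝ ∞ (fun m : Chart n => Γ m.1 c a b) W := fun c =>
      (hΓ.smooth c a b).comp contDiffOn_fst hWU
    exact (hc _).sub (ContDiffOn.sum fun k _ => (hp k).mul (hc _))
  simp only [tilt, Matrix.of_apply]
  refine ContDiffOn.sum fun j _ => ?_
  split_ifs
  · exact ((hG _ _).add ((hp j).mul (hG _ _))).neg
  · exact hp j
  · exact contDiffOn_const
  · exact contDiffOn_const

include hU hΓ hWU in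
theorem contDiffOn_pullbackGauge (v : Chart n) (r s : Fin (n + 2)) :
    ContDiffOn ℝ ∞ (fun m => pullbackGauge Γ m v r s) W :=
  (contDiffOn_projGauge hU hΓ v.1 r s).comp contDiffOn_fst hWU

include hU hΓ hW hWU in
theorem contDiffOn_normalGauge (v : Chart n) (r s : Fin (n + 2)) :
    ContDiffOn ℝ ∞ (fun m => normalGauge Γ m v r s) W := by
  have hN := contDiffOn_tilt hΓ hWU
  simp only [normalGauge, unipotentTransform_apply, Matrix.add_apply, Matrix.sub_apply,
    Matrix.mul_apply, matDeriv, Matrix.of_apply]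
  refine ContDiffOn.add (ContDiffOn.sum fun k _ => ContDiffOn.mul (ContDiffOn.sum fun l _ =>
    ContDiffOn.mul (contDiffOn_const.sub (hN _ _)) (contDiffOn_pullbackGauge hU hΓ hWU v _ _))
    (contDiffOn_const.add (hN _ _))) ?_
  exact ((hN r s).fderiv_of_isOpen hW (by simp)).clm_apply contDiffOn_const

theorem trace_normalGauge (hΓtr : ∀ x ∈ U, ∀ c, ∑ a, Γ x a a c = 0) {m : Chart n}
    (hm : m.1 ∈ U) (v : Chart n) : (normalGauge Γ m v).trace = 0 := by
  have hD := IsOuterMiddle.matDeriv (isOuterMiddle_tilt Γ) m v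
  have h1 : (1 + tilt Γ m) * (1 - tilt Γ m) = 1 := by
    have : (1 + tilt Γ m) * (1 - tilt Γ m) = 1 - tilt Γ m * tilt Γ m := by noncomm_ring
    rw [this, (isOuterMiddle_tilt Γ m).mul_eq_zero (isOuterMiddle_tilt Γ m), sub_zero]
  rw [normalGauge, unipotentTransform_apply, Matrix.trace_add, Matrix.mul_assoc,
    Matrix.trace_mul_comm, Matrix.mul_assoc, h1, mul_one]
  have h2 : (matDeriv (tilt Γ) m v).trace = 0 := by
    simp [Matrix.trace, sum_blocks (n := n), hD.1, hD.2]
  have h3 : (pullbackGauge Γ m v).trace = 0 := by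
    simp only [Matrix.trace, Matrix.diag, Fin.sum_univ_succ (n := n + 1), pullbackGauge,
      LinearMap.comp_apply, LinearMap.fst_apply, projGauge_zero_zero, projGauge_succ_succ]
    rw [Finset.sum_comm, zero_add]
    refine Finset.sum_eq_zero fun c _ => ?_
    rw [← Finset.sum_mul, hΓtr m.1 hm c, zero_mul]
  rw [h2, h3, add_zero]

include hU hΓ in
theorem gaugeCurvature_pullbackGauge {m : Chart n} (hm : m.1 ∈ U) (v w : Chart n) :
    gaugeCurvature (pullbackGauge Γ) m v w = projCurv Γ m.1 v.1 w.1 := by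
  have h : ∀ (v w : Chart n) r s, fderiv ℝ (fun m' => pullbackGauge Γ m' w r s) m v
      = fderiv ℝ (fun x' => projGauge Γ x' w.1 r s) m.1 v.1 := fun v w r s => by
    have := ((differentiableAt_projGauge hU hΓ hm w.1 r s).hasFDerivAt.comp m
      (ContinuousLinearMap.fst ℝ (Base n) (Fin n → ℝ)).hasFDerivAt).fderiv
    exact congrArg (fun L => L v) this
  ext r s
  simp only [gaugeCurvature, projCurv, Matrix.add_apply, Matrix.of_apply, h]
  rfl

/-- The base components of an element of `g/p` in the frame at `m`. -/
def baseComponent {n : ℕ} (m : Chart n) : Mat n →ₗ[ℝ] Base n :=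
  LinearMap.pi fun a => Fin.lastCases
    (entry (Fin.last (n + 1)) 0 + ∑ i, m.2 i • entry (mid i) 0) (fun i => entry (mid i) 0) a

theorem baseComponent_castSucc (m : Chart n) (X : Mat n) (i : Fin n) :
    baseComponent m X (Fin.castSucc i) = X (mid i) 0 := by
  simp [baseComponent, entry]

theorem baseComponent_last (m : Chart n) (X : Mat n) :
    baseComponent m X (Fin.last n)
      = X (Fin.last (n + 1)) 0 + ∑ i, m.2 i * X (mid i) 0 := by
  simp [baseComponent, entry]

theorem baseComponent_eq_zero (m : Chart n) {X : Mat n} (h1 : ∀ i, X (mid i) 0 = 0)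
    (h2 : X (Fin.last (n + 1)) 0 = 0) : baseComponent m X = 0 := by
  funext a
  refine Fin.lastCases ?_ (fun i => ?_) a
  · simp [baseComponent_last, h1, h2]
  · simp [baseComponent_castSucc, h1]

theorem baseComponent_single_mid (m : Chart n) (i : Fin n) :
    baseComponent m (Matrix.single (mid i) 0 1)
      = Pi.single (Fin.castSucc i) 1 + m.2 i • Pi.single (Fin.last n) 1 := by
  funext a
  refine Fin.lastCases ?_ (fun k => ?_) a
  · simp [baseComponent_last, Matrix.single_apply]
  · simp [baseComponent_castSucc, Matrix.single_apply, Pi.single_apply, eq_comm]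

theorem baseComponent_single_last (m : Chart n) :
    baseComponent m (Matrix.single (Fin.last (n + 1)) 0 1) = Pi.single (Fin.last n) 1 := by
  funext a
  refine Fin.lastCases ?_ (fun k => ?_) a
  · simp [baseComponent_last]
  · simp [baseComponent_castSucc]

include hU hΓ hW hWU in
-- The curvature is the conjugated projective curvature, evaluated on base components, so it
-- vanishes as soon as one argument lies in `F`. With the zero first column this leaves only the row
-- `0` of the codifferential, which is the Ricci-type contraction.
theorem isNormal_normalGauge (hn : 1 ≤ n) (hΓtr : ∀ x ∈ U, ∀ c, ∑ a, Γ x a a c = 0) :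
    IsNormal W (normalGauge Γ) := by
  intro m hm
  have hmU := hWU m hm
  let κ : Mat n →ₗ[ℝ] Mat n →ₗ[ℝ] Mat n := LinearMap.mk₂ ℝ
    (fun X Y => (1 - tilt Γ m) * projCurv Γ m.1 (baseComponent m X) (baseComponent m Y)
      * (1 + tilt Γ m))
    (fun X X' Y => by
      rw [map_add, projCurv_add_left hU hΓ hmU, Matrix.mul_add (1 - tilt Γ m), Matrix.add_mul])
    (fun t X Y => by
      rw [map_smul, projCurv_smul_left hU hΓ hmU, Matrix.mul_smul, Matrix.smul_mul])
    (fun X Y Y' => by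
      rw [map_add, projCurv_add_right hU hΓ hmU, Matrix.mul_add (1 - tilt Γ m), Matrix.add_mul])
    (fun t X Y => by
      rw [map_smul, projCurv_smul_right hU hΓ hmU, Matrix.mul_smul, Matrix.smul_mul])
  have hκ : ∀ X Y, κ X Y = (1 - tilt Γ m)
      * projCurv Γ m.1 (baseComponent m X) (baseComponent m Y) * (1 + tilt Γ m) := fun X Y => rfl
  have hl : ∀ X Y, baseComponent m X = 0 → κ X Y = 0 := fun X Y h => by
    have h0 := projCurv_smul_left hU hΓ hmU 0 0 (baseComponent m Y)
    rw [zero_smul, zero_smul] at h0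
    rw [hκ, h, h0, mul_zero, zero_mul]
  have hr : ∀ X Y, baseComponent m Y = 0 → κ X Y = 0 := fun X Y h => by
    have h0 := projCurv_smul_right hU hΓ hmU 0 (baseComponent m X) 0
    rw [zero_smul, zero_smul] at h0
    rw [hκ, h, h0, mul_zero, zero_mul]
  have hcol : ∀ X Y r, κ X Y r 0 = 0 := fun X Y r => by
    rw [hκ, mul_one_add_tilt_zero, Matrix.mul_apply]
    simp [projCurv_apply_zero hU hΓ hmU]
  have hric : ∀ X s, ∑ i, κ X (Matrix.single (mid i) 0 1) (mid i) s
      + κ X (Matrix.single (Fin.last (n + 1)) 0 1) (Fin.last (n + 1)) s = 0 := fun X s => by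
    have key : ∀ s, ∑ i : Fin n, projCurv Γ m.1 (baseComponent m X) (Pi.single (Fin.castSucc i) 1)
        (mid i) s + projCurv Γ m.1 (baseComponent m X) (Pi.single (Fin.last n) 1)
          (Fin.last (n + 1)) s = 0 := fun s => by
      have := sum_projCurv_single hU hΓ hn hΓtr hmU (baseComponent m X) s
      rwa [sum_base] at this
    -- The frame `∂_i + p_i ∂_{n+1}`, `∂_{n+1}` and the rows modified by `1 - tilt Γ m` are changed
    -- by mutually inverse matrices, so the contraction is unaffected.
    have key2 : ∀ s, ∑ i, ((1 - tilt Γ m) * projCurv Γ m.1 (baseComponent m X)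
          (baseComponent m (Matrix.single (mid i) 0 1))) (mid i) s
        + ((1 - tilt Γ m) * projCurv Γ m.1 (baseComponent m X)
          (baseComponent m (Matrix.single (Fin.last (n + 1)) 0 1))) (Fin.last (n + 1)) s = 0 :=
        fun s => by
      simp only [one_sub_tilt_mul_mid, one_sub_tilt_mul_last, baseComponent_single_mid,
        baseComponent_single_last, projCurv_add_right hU hΓ hmU, projCurv_smul_right hU hΓ hmU,
        Matrix.add_apply, Matrix.smul_apply, smul_eq_mul, Finset.sum_add_distrib]
      linarith [key s]
    have hmul : ∀ (Z : Mat n) r, (Z * (1 + tilt Γ m)) r s = ∑ t, Z r t * (1 + tilt Γ m) t s :=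
      fun _ _ => Matrix.mul_apply
    simp only [hκ, hmul]
    rw [Finset.sum_comm, ← Finset.sum_add_distrib]
    exact Finset.sum_eq_zero fun t _ => by rw [← Finset.sum_mul, ← add_mul, key2, zero_mul]
  refine ⟨κ, ⟨fun X Y hX => ?_, fun v w => ?_⟩, fun X => ?_⟩
  · obtain ⟨h1, -, h3⟩ := (isBlockUpper_iff X).1 hX
    have h0 := baseComponent_eq_zero m h1 h3
    exact ⟨hl X Y h0, hr Y X h0⟩
  · have hco := hasCoframe_normalGauge hΓ hWU
    have hb : ∀ v, baseComponent m (normalGauge Γ m v) = v.1 := fun v => by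
      funext a
      refine Fin.lastCases ?_ (fun k => ?_) a
      · rw [baseComponent_last, hco.sigma m hm]
        simp [hco.theta m hm]
      · rw [baseComponent_castSucc, hco.theta m hm]
    rw [hκ, hb, hb, normalGauge, gaugeCurvature_unipotentTransform (isOuterMiddle_tilt Γ)
      (fun r s => (contDiffOn_tilt hΓ hWU r s).contDiffAt (hW.mem_nhds hm))
      (fun v r s => ((contDiffOn_pullbackGauge hU hΓ hWU v r s).contDiffAt
        (hW.mem_nhds hm)).differentiableAt (by simp)),
      gaugeCurvature_pullbackGauge hU hΓ hmU]
  · ext r s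
    -- All bracket terms vanish: `[E_{0s}, X]` has no base component, and in the remaining family
    -- the second argument lies in `F`.
    have e1 : ∀ i : Fin n, baseComponent m (Matrix.single 0 (mid i) (1 : ℝ) * X
        - X * Matrix.single 0 (mid i) (1 : ℝ)) = 0 := fun i =>
      baseComponent_eq_zero m (by simp)
        (by simp)
    have e2 : baseComponent m (Matrix.single 0 (Fin.last (n + 1)) (1 : ℝ) * X
        - X * Matrix.single 0 (Fin.last (n + 1)) (1 : ℝ)) = 0 :=
      baseComponent_eq_zero m (by simp)
        (by simp)
    have e3 : ∀ j : Fin n,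
        baseComponent m (Matrix.single (Fin.last (n + 1)) (mid j) (1 : ℝ)) = 0 := fun j =>
      baseComponent_eq_zero m (by simp) (by simp)
    rw [kostantCodiff_apply]
    simp only [fun i Y => hl _ Y (e1 i), fun Y => hl _ Y e2, fun j Y => hr Y _ (e3 j), hcol,
      Matrix.zero_apply, ite_self, sub_zero, Finset.sum_const_zero, add_zero, mul_zero]
    by_cases h : r = 0
    · simp only [h, if_true, hric]
    · simp [h]

include hU hΓ hW hWU in
/-- The normal parabolic geometry has an adapted gauge over every open set of the chart. -/
theorem isNormalAdaptedGauge_normalGauge (hn : 1 ≤ n)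
    (hΓtr : ∀ x ∈ U, ∀ c, ∑ a, Γ x a a c = 0) :
    IsNormalAdaptedGauge U Γ W (normalGauge Γ) :=
  (hasCoframe_normalGauge hΓ hWU).isNormalAdaptedGauge hn hΓ hWU
    (contDiffOn_normalGauge hU hΓ hW hWU)
    (fun m hm v => trace_normalGauge hΓtr (hWU m hm) v)
    (isNormal_normalGauge hU hΓ hW hWU hn hΓtr)

end gauge

/-! ### The Fefferman metric -/

/-- Substituting `u = σ + p_i dx^i` splits the form into its restriction to `σ = 0`, given by
`-slope Γ`, and a multiple of `σ`. The other factor of that multiple is precisely the corner trace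
in `normalGauge_corners`. -/
theorem contracted_quadratic {n : ℕ} {U : Set (Base n)} {Γ : Christoffel n}
    (hΓ : IsTorsionFreeConnection U Γ) {m : Chart n} (hm : m.1 ∈ U) (v : Chart n) :
    ∑ b, ∑ c, contracted Γ m b c * (v.1 b * v.1 c)
      = -∑ j, (∑ i, slope Γ m i j * v.1 (Fin.castSucc i)) * v.1 (Fin.castSucc j)
        + (∑ j, (contracted Γ m (Fin.castSucc j) (Fin.last n)
          + m.2 j * contracted Γ m (Fin.last n) (Fin.last n)) * v.1 (Fin.castSucc j)
        + ∑ c, contracted Γ m (Fin.last n) c * v.1 c) * tautForm m v := by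
  set g := contracted Γ m (Fin.last n) (Fin.last n) with hg
  set P := ∑ i, m.2 i * v.1 (Fin.castSucc i) with hP
  set b := ∑ j, contracted Γ m (Fin.last n) (Fin.castSucc j) * v.1 (Fin.castSucc j) with hb
  set u := v.1 (Fin.last n) with hu
  set a := ∑ j : Fin n, ∑ i : Fin n, contracted Γ m (Fin.castSucc j) (Fin.castSucc i)
    * (v.1 (Fin.castSucc j) * v.1 (Fin.castSucc i)) with ha
  have hs : ∀ j : Fin n, contracted Γ m (Fin.castSucc j) (Fin.last n)
      = contracted Γ m (Fin.last n) (Fin.castSucc j) := fun j => contracted_symm hΓ hm _ _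
  have h1 : ∑ b, ∑ c, contracted Γ m b c * (v.1 b * v.1 c) = a + 2 * b * u + g * u ^ 2 := by
    have e : ∀ j : Fin n, contracted Γ m (Fin.last n) (Fin.castSucc j)
          * (v.1 (Fin.castSucc j) * u)
        = (contracted Γ m (Fin.last n) (Fin.castSucc j) * v.1 (Fin.castSucc j)) * u :=
      fun j => by ring
    have e' : ∀ j : Fin n, contracted Γ m (Fin.last n) (Fin.castSucc j)
          * (u * v.1 (Fin.castSucc j))
        = (contracted Γ m (Fin.last n) (Fin.castSucc j) * v.1 (Fin.castSucc j)) * u :=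
      fun j => by ring
    simp only [sum_base (n := n), Finset.sum_add_distrib, hs, ← hu, e, e', ← Finset.sum_mul,
      ← hb, ← hg, ← ha]
    ring
  have h2 : -∑ j, (∑ i, slope Γ m i j * v.1 (Fin.castSucc i)) * v.1 (Fin.castSucc j)
      = a + 2 * P * b + P ^ 2 * g := by
    have e : ∀ j, ∑ i, slope Γ m i j * v.1 (Fin.castSucc i)
        = -(∑ i, contracted Γ m (Fin.castSucc j) (Fin.castSucc i) * v.1 (Fin.castSucc i)
          + P * contracted Γ m (Fin.last n) (Fin.castSucc j) + m.2 j * b + m.2 j * P * g) :=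
        fun j => by
      rw [hP, hb, Finset.sum_mul, Finset.mul_sum, Finset.mul_sum, Finset.sum_mul,
        ← Finset.sum_add_distrib, ← Finset.sum_add_distrib, ← Finset.sum_add_distrib,
        ← Finset.sum_neg_distrib]
      refine Finset.sum_congr rfl fun i _ => ?_
      rw [slope_symm hΓ hm, slope]
      ring
    have e2 : ∀ j, (∑ i, slope Γ m i j * v.1 (Fin.castSucc i)) * v.1 (Fin.castSucc j)
        = -(∑ i, contracted Γ m (Fin.castSucc j) (Fin.castSucc i)
            * (v.1 (Fin.castSucc j) * v.1 (Fin.castSucc i))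
          + P * (contracted Γ m (Fin.last n) (Fin.castSucc j) * v.1 (Fin.castSucc j))
          + (m.2 j * v.1 (Fin.castSucc j)) * (b + P * g)) := fun j => by
      have e3 : ∑ i : Fin n, contracted Γ m (Fin.castSucc j) (Fin.castSucc i)
            * (v.1 (Fin.castSucc j) * v.1 (Fin.castSucc i))
          = (∑ i : Fin n, contracted Γ m (Fin.castSucc j) (Fin.castSucc i)
            * v.1 (Fin.castSucc i)) * v.1 (Fin.castSucc j) := by
        rw [Finset.sum_mul]
        exact Finset.sum_congr rfl fun i _ => by ring
      rw [e j, e3]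
      ring
    simp only [e2, Finset.sum_neg_distrib, Finset.sum_add_distrib, ← Finset.mul_sum,
      ← Finset.sum_mul, ← hb, ← hP, ← ha, neg_neg]
    ring
  have h3 : ∑ j, (contracted Γ m (Fin.castSucc j) (Fin.last n) + m.2 j * g)
      * v.1 (Fin.castSucc j) = b + P * g := by
    rw [hb, hP, Finset.sum_mul, ← Finset.sum_add_distrib]
    exact Finset.sum_congr rfl fun j _ => by rw [hs]; ring
  have h4 : ∑ c, contracted Γ m (Fin.last n) c * v.1 c = b + g * u := sum_base _
  rw [h1, h2, h3, h4, tautForm, ← hu, ← hP]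
  ring

/-- The diagonal of `fiberCurve`. -/
def fiberDiag {n : ℕ} (ε : Bool) (s : ℝ) (r : Fin (n + 2)) : ℝ :=
  (if ε = true ∧ n ≤ r.val then -1 else 1) * Real.exp (if blk r = 1 then -(2 * s / n) else s)

theorem fiberDiag_ne_zero {n : ℕ} (ε : Bool) (s : ℝ) (r : Fin (n + 2)) :
    fiberDiag ε s r ≠ 0 := by
  unfold fiberDiag
  split_ifs <;> simp

theorem fiberCurve_eq {n : ℕ} (ε : Bool) (s : ℝ) :
    (fiberCurve ε s : Mat n) = Matrix.diagonal (fiberDiag ε s) := rfl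

theorem fiberCurve_inv {n : ℕ} (ε : Bool) (s : ℝ) :
    (fiberCurve ε s : Mat n)⁻¹ = Matrix.diagonal fun r => (fiberDiag ε s r)⁻¹ := by
  refine Matrix.inv_eq_right_inv ?_
  rw [fiberCurve_eq, Matrix.diagonal_mul_diagonal]
  simp [fiberDiag_ne_zero]

theorem cartanForm_liftDeriv_offDiag {n : ℕ} (A : Chart n → Chart n →ₗ[ℝ] Mat n) (ε : Bool)
    (z ξ : FSpace n) {r t : Fin (n + 2)} (h : r ≠ t) :
    cartanForm A z.1 (fiberCurve ε z.2) (liftDeriv ε z.2 ξ) r t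
      = (fiberDiag ε z.2 r)⁻¹ * A z.1 ξ.1 r t * fiberDiag ε z.2 t := by
  have h0 : ∀ τ, (fiberCurve ε τ : Mat n) r t = 0 := fun τ => Matrix.diagonal_apply_ne _ h
  change ((fiberCurve ε z.2 : Mat n)⁻¹ * A z.1 ξ.1 * fiberCurve ε z.2
    + (fiberCurve ε z.2 : Mat n)⁻¹ * (ξ.2 • Matrix.of fun r t =>
      deriv (fun τ => (fiberCurve ε τ : Mat n) r t) z.2) : Mat n) r t = _
  rw [fiberCurve_inv, Matrix.add_apply, Matrix.diagonal_mul]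
  simp only [Matrix.smul_apply, Matrix.of_apply, h0, deriv_const, smul_zero, mul_zero, add_zero]
  rw [fiberCurve_eq, Matrix.mul_diagonal, Matrix.diagonal_mul]

theorem cartanForm_liftDeriv_diag {n : ℕ} (A : Chart n → Chart n →ₗ[ℝ] Mat n) (ε : Bool)
    (z ξ : FSpace n) {r : Fin (n + 2)} (h : blk r ≠ 1) :
    cartanForm A z.1 (fiberCurve ε z.2) (liftDeriv ε z.2 ξ) r r = A z.1 ξ.1 r r + ξ.2 := by
  have h0 : ∀ τ, (fiberCurve ε τ : Mat n) r r
      = (if ε = true ∧ n ≤ r.val then -1 else 1) * Real.exp τ := fun τ => by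
    simp [fiberCurve, h]
  have h1 : fiberDiag ε z.2 r = (if ε = true ∧ n ≤ r.val then -1 else 1) * Real.exp z.2 := by
    simp [fiberDiag, h]
  have h2 : deriv (fun τ => (fiberCurve ε τ : Mat n) r r) z.2 = fiberDiag ε z.2 r := by
    simp only [h0, h1]
    rw [deriv_const_mul _ Real.differentiableAt_exp, Real.deriv_exp]
  change ((fiberCurve ε z.2 : Mat n)⁻¹ * A z.1 ξ.1 * fiberCurve ε z.2
    + (fiberCurve ε z.2 : Mat n)⁻¹ * (ξ.2 • Matrix.of fun r t =>
      deriv (fun τ => (fiberCurve ε τ : Mat n) r t) z.2) : Mat n) r r = _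
  rw [fiberCurve_inv, Matrix.add_apply, Matrix.diagonal_mul]
  simp only [Matrix.smul_apply, Matrix.of_apply, h2]
  rw [fiberCurve_eq, Matrix.mul_diagonal, Matrix.diagonal_mul, smul_eq_mul]
  have := fiberDiag_ne_zero (n := n) ε z.2 r
  field_simp

/-- The value of the Fefferman form of a gauge on the component `ε`. -/
theorem feffermanForm_cartanForm {n : ℕ} (hn : 1 ≤ n) (A : Chart n → Chart n →ₗ[ℝ] Mat n)
    (ε : Bool) (z ξ : FSpace n) :
    feffermanForm n (cartanForm A z.1 (fiberCurve ε z.2) (liftDeriv ε z.2 ξ))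
      = (if ε then -1 else 1) * (∑ i, A z.1 ξ.1 (Fin.last (n + 1)) (mid i) * A z.1 ξ.1 (mid i) 0
        + (A z.1 ξ.1 0 0 + A z.1 ξ.1 (Fin.last (n + 1)) (Fin.last (n + 1)) + 2 * ξ.2)
          * A z.1 ξ.1 (Fin.last (n + 1)) 0) := by
  -- Both corner exponentials are `e^s` and cancel, so the form does not depend on `s`. The sign
  -- comes from `J`, whose first diagonal entry is `1` because `n ≥ 1`; the signs in the middle
  -- block cancel in the product `Yᵗ X`.
  have hd : (fiberDiag ε z.2 (Fin.last (n + 1)))⁻¹ * fiberDiag ε z.2 (0 : Fin (n + 2))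
      = if ε then -1 else 1 := by
    have : ¬ n ≤ 0 := by omega
    cases ε <;> simp [fiberDiag, this]
  have hform : ∀ X : Mat n, feffermanForm n X = ∑ i : Fin n, X (Fin.last (n + 1)) (mid i)
      * X (mid i) 0 + (X 0 0 + X (Fin.last (n + 1)) (Fin.last (n + 1)))
        * X (Fin.last (n + 1)) 0 := fun X => by
    simp [feffermanForm, QuadraticMap.linMulLin_apply, entry]
    ring
  rw [hform, cartanForm_liftDeriv_diag _ _ _ _ (by simp),
    cartanForm_liftDeriv_diag _ _ _ _ (by simp), ← hd]
  simp only [cartanForm_liftDeriv_offDiag _ _ _ _ (last_ne_mid _),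
    cartanForm_liftDeriv_offDiag _ _ _ _ (mid_ne_zero _),
    cartanForm_liftDeriv_offDiag _ _ _ _ last_ne_zero']
  rw [mul_add, Finset.mul_sum]
  congr 1
  · refine Finset.sum_congr rfl fun i _ => ?_
    have := fiberDiag_ne_zero (n := n) ε z.2 (mid i)
    field_simp
  · ring

theorem explicitMetric_apply {n : ℕ} (Γ : Christoffel n) (z ξ : FSpace n) :
    explicitMetric Γ z ξ = ∑ b, ∑ c, contracted Γ z.1 b c * (ξ.1.1 b * ξ.1.1 c)
      + ∑ i, ξ.1.1 (Fin.castSucc i) * ξ.1.2 i + 2 * (tautForm z.1 ξ.1 * ξ.2) := by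
  simp [explicitMetric, QuadraticMap.linMulLin_apply, dx, dp, ds, contracted, tautForm]

/-- An arbitrary normal adapted gauge shares its coframe with `normalGauge Γ`, hence also its corner
trace. The conformal factor is the constant sign of the component. -/
theorem explicitMetric_mem_feffermanClass {n : ℕ} (hn : 1 ≤ n) {U : Set (Base n)}
    (hU : IsOpen U) {Γ : Christoffel n} (hΓ : IsTorsionFreeConnection U Γ)
    (hΓtr : ∀ x ∈ U, ∀ c, ∑ a, Γ x a a c = 0) {W : Set (Chart n)} (hW : IsOpen W)
    (hWU : ∀ m ∈ W, m.1 ∈ U) {A : Chart n → Chart n →ₗ[ℝ] Mat n}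
    (hA : IsNormalAdaptedGauge U Γ W A) (ε : Bool) :
    explicitMetric Γ ∈ feffermanClass W A ε := by
  have hB := isNormalAdaptedGauge_normalGauge hU hΓ hW hWU hn hΓtr
  have hAc := hA.hasCoframe hn hΓ hWU
  have hBc := hB.hasCoframe hn hΓ hWU
  refine ⟨fun _ => if ε then -1 else 1, contDiffOn_const, fun z hz => ⟨by split_ifs <;> simp, ?_⟩⟩
  ext ξ
  rw [_root_.smul_apply, QuadraticMap.comp_apply, LinearMap.comp_apply,
    feffermanForm_cartanForm hn, explicitMetric_apply, contracted_quadratic hΓ (hWU _ hz),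
    corner_trace_unique hW hAc hBc hA.cartan hB.cartan hA.normal hB.normal hz,
    normalGauge_corners, hAc.sigma _ hz, smul_eq_mul]
  have hsq : ∀ x : ℝ, (if ε then -1 else 1 : ℝ) * ((if ε then -1 else 1) * x) = x := fun x => by
    split_ifs <;> ring
  rw [hsq]
  simp only [hAc.pi _ hz, hAc.theta _ hz, sub_mul (ξ.1.2 _), Finset.sum_sub_distrib, tautForm,
    mul_comm (ξ.1.1 _) (ξ.1.2 _)]
  ring

/-! ### The Patterson–Walker metric -/

theorem hasFDerivAt_coordChange {n : ℕ} (z : Cot n) (hz : z.2 (Fin.last n) ≠ 0) :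
    ∃ L : Cot n →L[ℝ] FSpace n, HasFDerivAt coordChange L z ∧ ∀ η, L η
      = ((η.1, fun i => -η.2 (Fin.castSucc i) / z.2 (Fin.last n)
        + z.2 (Fin.castSucc i) * η.2 (Fin.last n) / z.2 (Fin.last n) ^ 2),
        -(1 / 2) * (η.2 (Fin.last n) / z.2 (Fin.last n))) := by
  obtain ⟨L, hL, hL'⟩ := hasFDerivAt_toChart z hz
  let Y : Cot n →L[ℝ] ℝ :=
    (ContinuousLinearMap.proj (R := ℝ) (φ := fun _ : Fin (n + 1) => ℝ) (Fin.last n)).comp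
      (ContinuousLinearMap.snd ℝ (Base n) (Fin (n + 1) → ℝ))
  have hY : HasFDerivAt (fun w : Cot n => w.2 (Fin.last n)) Y z := Y.hasFDerivAt
  have hlog := (hY.log hz).const_mul (-(1 / 2))
  -- `Real.log` already ignores the sign of its argument, so the absolute value can be dropped and
  -- both signs of `y_{n+1}` are treated at once.
  have hc : (coordChange : Cot n → FSpace n)
      = fun w => (toChart w, -(1 / 2) * Real.log (w.2 (Fin.last n))) := by
    funext w
    simp [coordChange]
  rw [hc]
  refine ⟨_, hL.prodMk hlog, fun η => ?_⟩
  refine Prod.ext (hL' η) ?_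
  simp [Y]
  field_simp

theorem pattersonWalker_apply {n : ℕ} (Γ : Christoffel n) (z η : Cot n) :
    pattersonWalker Γ z η = ∑ a, η.1 a * η.2 a
      - ∑ a, ∑ b, (∑ c, z.2 c * Γ z.1 c a b) * (η.1 a * η.1 b) := by
  simp [pattersonWalker, QuadraticMap.linMulLin_apply]

theorem pattersonWalker_eq_pullback {n : ℕ} (Γ : Christoffel n) (z : Cot n)
    (hz : z.2 (Fin.last n) ≠ 0) :
    pattersonWalker Γ z = (-z.2 (Fin.last n)) •
      (explicitMetric Γ (coordChange z)).comp
        (fderiv ℝ coordChange z : Cot n →ₗ[ℝ] FSpace n) := by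
  obtain ⟨L, hL, hL'⟩ := hasFDerivAt_coordChange z hz
  ext η
  rw [_root_.smul_apply, QuadraticMap.comp_apply, hL.fderiv, ContinuousLinearMap.coe_coe,
    hL', explicitMetric_apply, pattersonWalker_apply, smul_eq_mul]
  have hG : ∀ b c, ∑ e, z.2 e * Γ z.1 e b c
      = z.2 (Fin.last n) * contracted Γ (coordChange z).1 b c := fun b c => by
    rw [sum_base, contracted, mul_sub, Finset.mul_sum, add_comm, sub_eq_add_neg,
      ← Finset.sum_neg_distrib]
    refine congrArg₂ _ rfl (Finset.sum_congr rfl fun k _ => ?_)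
    simp only [coordChange, toChart]
    field_simp
  simp only [hG, sum_base (fun a => η.1 a * η.2 a), tautForm, mul_assoc, ← Finset.mul_sum]
  -- Here `dx^i ⊙ dp_i` is expressed through `dy_a`. The `p_i`-term cancels against that of `2 σ ⊙
  -- ds = -σ ⊙ dy_{n+1} / y_{n+1}`, and `-(dx^a ⊙ dy_a) / y_{n+1}` remains.
  have e : ∑ i : Fin n, η.1 (Fin.castSucc i) * (-η.2 (Fin.castSucc i) / z.2 (Fin.last n)
        + z.2 (Fin.castSucc i) * η.2 (Fin.last n) / z.2 (Fin.last n) ^ 2)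
      = -(∑ i : Fin n, η.1 (Fin.castSucc i) * η.2 (Fin.castSucc i)) / z.2 (Fin.last n)
        - (∑ i : Fin n, (coordChange z).1.2 i * η.1 (Fin.castSucc i)) * η.2 (Fin.last n)
          / z.2 (Fin.last n) := by
    rw [Finset.sum_mul, Finset.sum_div, ← Finset.sum_neg_distrib, Finset.sum_div,
      ← Finset.sum_sub_distrib]
    refine Finset.sum_congr rfl fun i _ => ?_
    simp only [coordChange, toChart]
    field_simp
    ring
  rw [e]
  field_simp
  ring

theorem isDiffeoOn_coordChange {n : ℕ} (U : Set (Base n)) {δ : ℝ} (hδ : δ * δ = 1) :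
    IsDiffeoOn coordChange {z : Cot n | z.1 ∈ U ∧ 0 < δ * z.2 (Fin.last n)}
      {z : FSpace n | z.1.1 ∈ U} := by
  have hδ0 : δ ≠ 0 := fun h => by simp [h] at hδ
  have hne : ∀ z : Cot n, 0 < δ * z.2 (Fin.last n) → z.2 (Fin.last n) ≠ 0 := fun z hz h => by
    simp [h] at hz
  have habs : |δ| = 1 := by
    rcases mul_self_eq_one_iff.1 hδ with h | h <;> simp [h]
  -- Solving `s = -½ log |y_{n+1}|` for `y_{n+1}`; the sign `δ = ±1` selects the half space.
  let y : FSpace n → ℝ := fun w => δ * Real.exp (-2 * w.2)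
  refine ⟨?_, fun z hz => hz.1, fun w => (w.1.1, Fin.snoc (fun i => -w.1.2 i * y w) (y w)),
    ?_, fun w hw => ⟨hw, ?_⟩, fun z hz => ?_, fun w hw => ?_⟩
  · have hlast : ContDiffOn ℝ ∞ (fun z : Cot n => z.2 (Fin.last n))
        {z : Cot n | z.1 ∈ U ∧ 0 < δ * z.2 (Fin.last n)} := by fun_prop
    have hc : (coordChange : Cot n → FSpace n)
        = fun w => ((w.1, fun i => -w.2 (Fin.castSucc i) / w.2 (Fin.last n)),
          -(1 / 2) * Real.log (w.2 (Fin.last n))) := by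
      funext w
      simp [coordChange, toChart]
    rw [hc]
    refine (contDiffOn_fst.prodMk (contDiffOn_pi.2 fun i => ContDiffOn.div ?_ hlast
      fun z hz => hne z hz.2)).prodMk (contDiffOn_const.mul (hlast.log fun z hz => hne z hz.2))
    fun_prop
  · have hy : ContDiff ℝ ∞ y := by fun_prop
    refine ContDiff.contDiffOn (ContDiff.prodMk (by fun_prop) (contDiff_pi.2 fun a => ?_))
    refine Fin.lastCases ?_ (fun i => ?_) a
    · simpa using hy
    · simp only [Fin.snoc_castSucc]
      exact ContDiff.mul (by fun_prop) hy
  · simp only [Fin.snoc_last, y, ← mul_assoc, hδ, one_mul]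
    exact Real.exp_pos _
  · have hy : y (coordChange z) = z.2 (Fin.last n) := by
      have h0 := hne z hz.2
      have h1 : |z.2 (Fin.last n)| = δ * z.2 (Fin.last n) := by
        rw [← abs_of_pos hz.2, abs_mul, habs, one_mul]
      simp only [y, coordChange]
      rw [show -2 * (-(1 / 2) * Real.log |z.2 (Fin.last n)|) = Real.log |z.2 (Fin.last n)| by ring,
        Real.exp_log (abs_pos.2 h0), h1, ← mul_assoc, hδ, one_mul]
    refine Prod.ext rfl (funext fun a => ?_)
    refine Fin.lastCases ?_ (fun i => ?_) a
    · simp [hy]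
    · have h0 := hne z hz.2
      simp only [Fin.snoc_castSucc, hy]
      simp only [coordChange, toChart]
      field_simp
  · have hy0 : y w ≠ 0 := mul_ne_zero hδ0 (Real.exp_ne_zero _)
    refine Prod.ext (Prod.ext rfl (funext fun i => ?_)) ?_
    · simp only [coordChange, toChart, Fin.snoc_castSucc, Fin.snoc_last]
      field_simp
    · simp only [coordChange, Fin.snoc_last, y, abs_mul, habs, one_mul, Real.abs_exp,
        Real.log_exp]
      ring

end LCFefferman

end

theorem proposition5p3 (n : ℕ) (hn : 1 ≤ n)
    (U : Set (LCFefferman.Base n)) (hU : IsOpen U)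
    (Γ : LCFefferman.Christoffel n)
    (hΓ : LCFefferman.IsTorsionFreeConnection U Γ)
    (hΓtr : ∀ x ∈ U, ∀ c, ∑ a, Γ x a a c = 0) :
    -- the Fefferman conformal class, over every open set of the chart lying over `U`
    (∀ W : Set (LCFefferman.Chart n), IsOpen W → (∀ m ∈ W, m.1 ∈ U) →
      (∃ A, LCFefferman.IsNormalAdaptedGauge U Γ W A) ∧
      ∀ A, LCFefferman.IsNormalAdaptedGauge U Γ W A →
        ∀ ε : Bool, LCFefferman.explicitMetric Γ ∈ LCFefferman.feffermanClass W A ε) ∧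
    -- the relation to the Patterson–Walker metric
    (LCFefferman.IsDiffeoOn LCFefferman.coordChange
        {z | z.1 ∈ U ∧ 0 < z.2 (Fin.last n)} {z | z.1.1 ∈ U} ∧
      LCFefferman.IsDiffeoOn LCFefferman.coordChange
        {z | z.1 ∈ U ∧ z.2 (Fin.last n) < 0} {z | z.1.1 ∈ U} ∧
      ∀ z : LCFefferman.Cot n, z.1 ∈ U → z.2 (Fin.last n) ≠ 0 →
        LCFefferman.pattersonWalker Γ z = (-z.2 (Fin.last n)) •
          (LCFefferman.explicitMetric Γ (LCFefferman.coordChange z)).comp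
            (fderiv ℝ LCFefferman.coordChange z : LCFefferman.Cot n →ₗ[ℝ] LCFefferman.FSpace n)) := by
  refine ⟨fun W hW hWU => ⟨⟨LCFefferman.normalGauge Γ,
    LCFefferman.isNormalAdaptedGauge_normalGauge hU hΓ hW hWU hn hΓtr⟩, fun A hA ε =>
    LCFefferman.explicitMetric_mem_feffermanClass hn hU hΓ hΓtr hW hWU hA ε⟩, ?_, ?_,
    fun z _ hz => LCFefferman.pattersonWalker_eq_pullback Γ z hz⟩
  · simpa using LCFefferman.isDiffeoOn_coordChange U (δ := 1) (by norm_num)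
  · simpa using LCFefferman.isDiffeoOn_coordChange U (δ := -1) (by norm_num)
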